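/- Let $N\ge 3$. Let $D^{1,2}(\mathbb{R}^N)$ be the completion of $C_c^\infty(\mathbb{R}^N)$ for the norm $\|\nabla v\|_{L^2}$, realized as a space of functions in $L^{2N/(N-2)}(\mathbb{R}^N)$, and let $$\mathcal{X}=D^{1,2}(\mathbb{R}^N)\cap\{\phi\in C^{0,1}(\mathbb{R}^N) : \|\nabla\phi\|_\infty\le 1\},\qquad \|\phi\|_{\mathcal{X}}=\Big(\int_{\mathbb{R}^N}|\nabla\phi|^2\,dx\Big)^{1/2}.$$ Let $\mathcal{X}^*$ be the set of linear functionals $\rho$ on the linear span of the convex set $\mathcal{X}$ whose restriction to $\mathcal{X}$ is continuous for the distance $\|\phi-\psi\|_{\mathcal{X}}$, and write $\langle\rho,\psi\rangle$ for the value of $\rho$ at $\psi$. For $\tau\in O(N)$ and $\phi\in\mathcal{X}$ put $\phi^\tau(x)=\phi(\tau x)$. Call $\phi\in\mathcal{X}$ radial if $\phi^\tau=\phi$ for all $\tau\in O(N)$, and call $\rho\in\mathcal{X}^*$ radially distributed if $\langle\rho,\psi^\tau\rangle=\langle\rho,\psi\rangle$ for all $\tau\in O(N)$ and $\psi\in\mathcal{X}$.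 Put $$I(\phi)=\int_{\mathbb{R}^N}\Big(1-\sqrt{1-|\nabla\phi|^2}\Big)\,dx-\langle\rho,\phi\rangle,\qquad \phi\in\mathcal{X}.$$ A weak solution of the Born–Infeld equation $$-\operatorname{div}\left(\frac{\nabla\phi}{\sqrt{1-|\nabla\phi|^2}}\right)=\rho\ \text{ in }\mathbb{R}^N,\qquad \lim_{|x|\to\infty}\phi(x)=0,$$ is a function $\phi\in\mathcal{X}$ such that $$\int_{\mathbb{R}^N}\frac{\nabla\phi\cdot\nabla\psi}{\sqrt{1-|\nabla\phi|^2}}\,dx=\langle\rho,\psi\rangle\qquad\text{for all }\psi\in\mathcal{X},$$ where it is understood that the integrand is defined almost everywhere (that is, $|\nabla\phi|<1$ a.e.) and integrable for every $\psi\in\mathcal{X}$. **Theorem.** If $\rho\in\mathcal{X}^*$ is radially distributed, then $I$ has a unique minimizer $\phi_\rho$ in $\mathcal{X}$, the function $\phi_\rho$ is radial, and $\phi_\rho$ is the unique weak solution of the Born–Infeld equation. -/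

import Mathlib

open MeasureTheory Filter Topology Gradient
open scoped ENNReal ContDiff

namespace BornInfeld

noncomputable section

/-- The Euclidean space `ℝ^N`. -/
abbrev Space (N : ℕ) : Type := EuclideanSpace ℝ (Fin N)

/-- The orthogonal group `O(N)`, as the linear isometries of `ℝ^N` onto itself. -/
abbrev OrthGroup (N : ℕ) : Type := Space N ≃ₗᵢ[ℝ] Space N

/-- `C_c^∞(ℝ^N)`. -/
def IsTest {N : ℕ} (v : Space N → ℝ) : Prop :=
  ContDiff ℝ ∞ v ∧ HasCompactSupport v

/-- The critical Sobolev exponent `2* = 2N/(N-2)` (used for `N ≥ 3`). -/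
def sobolevExp (N : ℕ) : ℝ≥0∞ := ENNReal.ofReal (2 * (N : ℝ) / ((N : ℝ) - 2))

/-- `u ∈ D^{1,2}(ℝ^N)`, the completion of `C_c^∞(ℝ^N)` for the norm `‖∇v‖_2` (for `N ≥ 3`).
A sequence of test functions that is Cauchy for this norm converges in `L^{2*}(ℝ^N)` by the Sobolev
inequality, and the element of the completion that it represents is its limit there. -/
def MemD12 {N : ℕ} (u : Space N → ℝ) : Prop :=
  ∃ v : ℕ → Space N → ℝ,
    (∀ n, IsTest (v n)) ∧
    (∀ ε : ℝ≥0∞, 0 < ε → ∃ n₀ : ℕ, ∀ m ≥ n₀, ∀ n ≥ n₀,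
      eLpNorm (fun x => ∇ (v m) x - ∇ (v n) x) 2 volume < ε) ∧
    Tendsto (fun n => eLpNorm (fun x => v n x - u x) (sobolevExp N) volume) atTop (𝓝 0)

/-- `𝒳 = D^{1,2}(ℝ^N) ∩ {φ ∈ C^{0,1}(ℝ^N) | ‖∇φ‖_∞ ≤ 1}`. A Lipschitz function is
differentiable almost everywhere, and `∇ φ` is its (almost everywhere defined) gradient, which is
also its weak gradient. -/
def X (N : ℕ) : Set (Space N → ℝ) :=
  {φ | MemD12 φ ∧ (∃ K, LipschitzWith K φ) ∧ ∀ᵐ x ∂(volume : Measure (Space N)), ‖∇ φ x‖ ≤ 1}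

/-- `‖φ‖_𝒳 = (∫ |∇φ|² dx)^{1/2}`. -/
def xNorm {N : ℕ} (φ : Space N → ℝ) : ℝ := Real.sqrt (∫ x, ‖∇ φ x‖ ^ 2)

/-- The dual `𝒳*`. The set `𝒳` is convex and symmetric, but is not a vector space; an element of
`𝒳*` is a linear functional on the vector space spanned by `𝒳` whose restriction to `𝒳` is
continuous for the distance `‖φ - ψ‖_𝒳`. -/
structure XDual (N : ℕ) where
  toLinearMap : Submodule.span ℝ (X N) →ₗ[ℝ] ℝ
  continuous_on_X : ∀ φ : X N, ∀ ε : ℝ, 0 < ε → ∃ δ : ℝ, 0 < δ ∧ ∀ ψ : X N,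
    xNorm (ψ.1 - φ.1) < δ →
      |toLinearMap ⟨ψ.1, Submodule.subset_span ψ.2⟩ -
        toLinearMap ⟨φ.1, Submodule.subset_span φ.2⟩| < ε

/-- The duality pairing `⟨ρ, φ⟩` of `ρ ∈ 𝒳*` and `φ ∈ 𝒳`. -/
def XDual.pairing {N : ℕ} (ρ : XDual N) (φ : X N) : ℝ :=
  ρ.toLinearMap ⟨φ.1, Submodule.subset_span φ.2⟩

/-- The functional `I(φ) = ∫ (1 - √(1 - |∇φ|²)) dx - ⟨ρ, φ⟩`; on `𝒳` the integrand lies between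
`0` and `|∇φ|²`, so it is integrable. -/
def action {N : ℕ} (ρ : XDual N) (φ : X N) : ℝ :=
  (∫ x, (1 - Real.sqrt (1 - ‖∇ φ.1 x‖ ^ 2))) - ρ.pairing φ

/-- `φ` minimizes the functional `I` on `𝒳`. -/
def IsMinimizer {N : ℕ} (ρ : XDual N) (φ : X N) : Prop :=
  ∀ ψ : X N, action ρ φ ≤ action ρ ψ

/-- `φ ∈ 𝒳` is a weak solution of `-div(∇φ/√(1 - |∇φ|²)) = ρ`, `φ(x) → 0` as `|x| → ∞`:
for all `ψ ∈ 𝒳`, `∫ ∇φ·∇ψ/√(1 - |∇φ|²) dx = ⟨ρ, ψ⟩`. That the integrals make sense is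
part of the definition: the denominator is non-zero almost everywhere (division by zero would
otherwise give the value `0` in Lean) and the integrands are integrable. -/
def IsWeakSolution {N : ℕ} (ρ : XDual N) (φ : X N) : Prop :=
  (∀ᵐ x ∂(volume : Measure (Space N)), ‖∇ φ.1 x‖ < 1) ∧
  ∀ ψ : X N,
    Integrable
      (fun x => inner ℝ (∇ φ.1 x) (∇ ψ.1 x) / Real.sqrt (1 - ‖∇ φ.1 x‖ ^ 2)) volume ∧
    ∫ x, inner ℝ (∇ φ.1 x) (∇ ψ.1 x) / Real.sqrt (1 - ‖∇ φ.1 x‖ ^ 2) = ρ.pairing ψ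

theorem gradient_comp_orth {N : ℕ} (τ : OrthGroup N) (f : Space N → ℝ) (x : Space N) :
    ∇ (fun y => f (τ y)) x = τ.symm (∇ f (τ x)) := by
  have h : fderiv ℝ (fun y => f (τ y)) x =
      (fderiv ℝ f (τ x)).comp (τ.toContinuousLinearEquiv : Space N →L[ℝ] Space N) :=
    τ.toContinuousLinearEquiv.comp_right_fderiv (f := f) (x := x)
  apply ext_inner_right ℝ
  intro w
  rw [gradient, InnerProductSpace.toDual_symm_apply, h]
  rw [← τ.inner_map_map, τ.apply_symm_apply, gradient, InnerProductSpace.toDual_symm_apply]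
  rfl

theorem eLpNorm_comp_orth {N : ℕ} {F : Type*} [NormedAddCommGroup F] (τ : OrthGroup N)
    (f : Space N → F) (p : ℝ≥0∞) :
    eLpNorm (fun x => f (τ x)) p volume = eLpNorm f p volume := by
  have hmp : MeasurePreserving (τ : Space N → Space N) volume volume := τ.measurePreserving
  have he : MeasurableEmbedding (τ : Space N → Space N) :=
    τ.toHomeomorph.measurableEmbedding
  have := he.eLpNorm_map_measure (g := f) (p := p) (μ := volume)
  rw [hmp.map_eq] at this
  exact this.symm

theorem comp_orth_mem {N : ℕ} (τ : OrthGroup N) {φ : Space N → ℝ} (hφ : φ ∈ X N) :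
    (fun x => φ (τ x)) ∈ X N := by
  obtain ⟨⟨v, hv, hc, ht⟩, ⟨K, hK⟩, hae⟩ := hφ
  refine ⟨⟨fun n x => v n (τ x), fun n => ⟨?_, ?_⟩, ?_, ?_⟩, ⟨K, ?_⟩, ?_⟩
  · exact (hv n).1.comp τ.contDiff
  · exact (hv n).2.comp_homeomorph τ.toHomeomorph
  · intro ε hε
    obtain ⟨n₀, h₀⟩ := hc ε hε
    refine ⟨n₀, fun m hm n hn => lt_of_eq_of_lt ?_ (h₀ m hm n hn)⟩
    rw [← eLpNorm_comp_orth τ (fun x => ∇ (v m) x - ∇ (v n) x)]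
    refine eLpNorm_congr_norm_ae (Eventually.of_forall fun x => ?_)
    rw [gradient_comp_orth, gradient_comp_orth, ← map_sub, τ.symm.norm_map]
  · refine ht.congr fun n => ?_
    exact (eLpNorm_comp_orth τ (fun x => v n x - φ x) _).symm
  · intro x y
    simpa using hK (τ x) (τ y)
  · have hmp : MeasurePreserving (τ : Space N → Space N) volume volume := τ.measurePreserving
    filter_upwards [hmp.quasiMeasurePreserving.ae hae] with x hx
    rwa [gradient_comp_orth, τ.symm.norm_map]

/-- `φ^τ(x) = φ(τ x)` for `τ ∈ O(N)`. -/
def rotate {N : ℕ} (τ : OrthGroup N) (φ : X N) : X N :=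
  ⟨fun x => φ.1 (τ x), comp_orth_mem τ φ.2⟩

/-- `φ ∈ 𝒳_rad`: `φ^τ = φ` for every `τ ∈ O(N)`. -/
def IsRadial {N : ℕ} (φ : X N) : Prop := ∀ τ : OrthGroup N, rotate τ φ = φ

/-- `ρ` is radially distributed: `ρ^τ = ρ` for every `τ ∈ O(N)`, where
`⟨ρ^τ, ψ⟩ = ⟨ρ, ψ^τ⟩` for all `ψ ∈ 𝒳`. -/
def IsRadiallyDistributed {N : ℕ} (ρ : XDual N) : Prop :=
  ∀ τ : OrthGroup N, ∀ ψ : X N, ρ.pairing (rotate τ ψ) = ρ.pairing ψ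

end

end BornInfeld

namespace BornInfeld

open scoped NNReal Convolution

/-! ### Almost everywhere defined gradients -/

section Gradient

variable {E : Type*} [NormedAddCommGroup E] [InnerProductSpace ℝ E] [CompleteSpace E]

/-! The density `1 - √(1 - |p|²)` is convex on the unit ball with a quadratic modulus
(`density_midpoint`), and `𝒳` is complete for the distance of gradients. Minimizing sequences are
therefore Cauchy, which gives existence without weak compactness; the same inequality gives
uniqueness (`exists_minimizer`, `minimizer_unique`). Rotations preserve the action, so the unique
minimizer is radial. Convexity also makes every weak solution a minimizer, which settles uniqueness
of weak solutions.

The difficulty is the Euler–Lagrange equation, since the constraint `|∇φ| ≤ 1` may be active and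
`1/√(1 - |∇φ|²)` may blow up. Comparing the minimizer `φ` with `(1 - t)φ` and letting `t → 0`,
Fatou's lemma bounds `∫ |∇φ|²/√(1 - |∇φ|²)` by `⟨ρ, φ⟩` (`IsMinimizer.lintegral_le`). Hence `|∇φ| <
1` almost everywhere and all integrals of the weak formulation converge. If moreover `∇η` vanishes
wherever `|∇φ| > 1 - κ`, then `φ + tη` is admissible for `|t| ≤ κ`, and minimality gives the
equation tested with `η` (`IsMinimizer.integral_flux_eq`).

Radial functions can be cut off in this way: the radial derivative of `η` is multiplied by the
indicator of a set of radii and integrated again (`exists_truncation`). Letting `κ → 0` yields the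
equation for every radial `η`. For an arbitrary `ψ`, the defect `∫ ∇φ·∇ψ/√(1 - |∇φ|²) - ⟨ρ, ψ⟩` is
rotation invariant. Among the functions with the same defect as `ψ`, the one of least norm is
unique, hence radial, hence of defect zero (`exists_isRadial_sub_eq`). -/

theorem norm_gradient (f : E → ℝ) (x : E) : ‖∇ f x‖ = ‖fderiv ℝ f x‖ :=
  (InnerProductSpace.toDual ℝ E).symm.norm_map _

theorem norm_gradient_sub (f g : E → ℝ) (x : E) :
    ‖∇ f x - ∇ g x‖ = ‖fderiv ℝ f x - fderiv ℝ g x‖ := by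
  rw [gradient, gradient, ← map_sub]
  exact (InnerProductSpace.toDual ℝ E).symm.norm_map _

theorem measurable_gradient [FiniteDimensional ℝ E] [MeasurableSpace E] [BorelSpace E]
    (f : E → ℝ) : Measurable (∇ f) :=
  (InnerProductSpace.toDual ℝ E).symm.continuous.measurable.comp (measurable_fderiv ℝ f)

theorem gradient_lincomb {f g : E → ℝ} {x : E} (hf : DifferentiableAt ℝ f x)
    (hg : DifferentiableAt ℝ g x) (a b : ℝ) :
    ∇ (a • f + b • g) x = a • ∇ f x + b • ∇ g x := by
  have h : fderiv ℝ (a • f + b • g) x = a • fderiv ℝ f x + b • fderiv ℝ g x :=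
    ((hf.hasFDerivAt.const_smul a).add (hg.hasFDerivAt.const_smul b)).fderiv
  simp [gradient, h]

theorem ae_gradient_lincomb [FiniteDimensional ℝ E] [MeasurableSpace E] [BorelSpace E]
    {μ : Measure E} [μ.IsAddHaarMeasure] {f g : E → ℝ} {K L : ℝ≥0} (hf : LipschitzWith K f)
    (hg : LipschitzWith L g) (a b : ℝ) :
    ∀ᵐ x ∂μ, ∇ (a • f + b • g) x = a • ∇ f x + b • ∇ g x := by
  filter_upwards [hf.ae_differentiableAt, hg.ae_differentiableAt] with x hx hx'
  exact gradient_lincomb hx hx' a b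

end Gradient

/-- Dominated convergence in `L^p`. -/
theorem tendsto_eLpNorm_sub_of_dominated {α F : Type*} [MeasurableSpace α] {μ : Measure α}
    [NormedAddCommGroup F] {p : ℝ≥0∞} (hp0 : p ≠ 0) (hp : p ≠ ⊤) {f : ℕ → α → F} {u : α → F}
    {g : α → ℝ} (hf : ∀ n, AEStronglyMeasurable (f n) μ) (hu : AEStronglyMeasurable u μ)
    (hg : MemLp g p μ) (hbound : ∀ n, ∀ᵐ x ∂μ, ‖f n x - u x‖ ≤ g x)
    (hlim : ∀ᵐ x ∂μ, Tendsto (fun n => f n x) atTop (𝓝 (u x))) :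
    Tendsto (fun n => eLpNorm (fun x => f n x - u x) p μ) atTop (𝓝 0) := by
  have hpos : 0 < p.toReal := ENNReal.toReal_pos hp0 hp
  simp only [eLpNorm_eq_lintegral_rpow_enorm_toReal hp0 hp]
  have h1 : Tendsto (fun n => ∫⁻ x, ‖f n x - u x‖ₑ ^ p.toReal ∂μ) atTop (𝓝 (∫⁻ _, 0 ∂μ)) := by
    refine tendsto_lintegral_of_dominated_convergence' (fun x => ‖g x‖ₑ ^ p.toReal)
      (fun n => ((hf n).sub hu).enorm.pow_const _) (fun n => ?_) ?_ ?_
    · filter_upwards [hbound n] with x hx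
      refine ENNReal.rpow_le_rpow ?_ hpos.le
      rw [← ofReal_norm, ← ofReal_norm]
      exact ENNReal.ofReal_le_ofReal (hx.trans (Real.le_norm_self _))
    · exact (lintegral_rpow_enorm_lt_top_of_eLpNorm_lt_top hp0 hp hg.2).ne
    · filter_upwards [hlim] with x hx
      have h2 : Tendsto (fun n => ‖f n x - u x‖ₑ) atTop (𝓝 0) := by
        have := (hx.sub_const (u x)).enorm
        simpa using this
      have h3 := (ENNReal.continuous_rpow_const (y := p.toReal)).tendsto 0 |>.comp h2
      simpa [Function.comp_def, ENNReal.zero_rpow_of_pos hpos] using h3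
  have h4 := (ENNReal.continuous_rpow_const (y := 1 / p.toReal)).tendsto 0
  rw [ENNReal.zero_rpow_of_pos (by positivity)] at h4
  simp only [lintegral_zero] at h1
  exact h4.comp h1

/-! ### Mollification of Lipschitz functions -/

section Mollify

variable {N : ℕ}

/-- Convolution with a normalized bump function. -/
noncomputable def mollify (b : ContDiffBump (0 : Space N)) (u : Space N → ℝ) : Space N → ℝ :=
  (b.normed volume ⋆[ContinuousLinearMap.lsmul ℝ ℝ, volume] u)

theorem mollify_contDiff (b : ContDiffBump (0 : Space N)) {u : Space N → ℝ} (hu : Continuous u) :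
    ContDiff ℝ ∞ (mollify b u) :=
  b.hasCompactSupport_normed.contDiff_convolution_left (n := (⊤ : ℕ∞)) _ b.contDiff_normed
    hu.locallyIntegrable

theorem mollify_hasCompactSupport (b : ContDiffBump (0 : Space N)) {u : Space N → ℝ}
    (hu : HasCompactSupport u) : HasCompactSupport (mollify b u) :=
  b.hasCompactSupport_normed.convolution _ hu

/-- The derivative falls on `u` rather than on the kernel, by Rademacher's theorem and domination by
the Lipschitz constant. Essential bounds on the gradient of `u` thus become pointwise bounds after
mollification. -/
theorem hasFDerivAt_mollify (b : ContDiffBump (0 : Space N)) {u : Space N → ℝ} {K : ℝ≥0}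
    (hu : LipschitzWith K u) (x : Space N) :
    HasFDerivAt (mollify b u)
      ((b.normed volume ⋆[ContinuousLinearMap.lsmul ℝ ℝ, volume] (fderiv ℝ u)) x) x := by
  have hb : Integrable (b.normed (volume : Measure (Space N))) volume :=
    b.continuous_normed.integrable_of_hasCompactSupport b.hasCompactSupport_normed
  refine (hasFDerivAt_integral_of_dominated_loc_of_lip
    (F := fun x t => b.normed volume t • u (x - t))
    (F' := fun t => b.normed volume t • fderiv ℝ u (x - t))
    (bound := fun t => b.normed volume t * K) univ_mem ?_ ?_ ?_ ?_ ?_ ?_).2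
  · exact Eventually.of_forall fun y => (b.continuous_normed.smul
      (hu.continuous.comp (continuous_const.sub continuous_id))).aestronglyMeasurable
  · exact (b.continuous_normed.smul (hu.continuous.comp
      (continuous_const.sub continuous_id))).integrable_of_hasCompactSupport
      b.hasCompactSupport_normed.smul_right
  · exact hb.aestronglyMeasurable.smul ((measurable_fderiv ℝ u).comp
      (measurable_const.sub measurable_id)).aestronglyMeasurable
  · refine Eventually.of_forall fun t => LipschitzWith.lipschitzOnWith ?_
    refine LipschitzWith.of_dist_le_mul fun y z => ?_
    have h0 : 0 ≤ b.normed volume t := b.nonneg_normed t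
    have := hu.dist_le_mul (y - t) (z - t)
    rw [dist_sub_right] at this
    rw [Real.coe_nnabs, dist_smul₀, Real.norm_of_nonneg h0,
      abs_of_nonneg (by positivity), mul_assoc]
    gcongr
  · exact hb.mul_const _
  · have h1 : ∀ᵐ t ∂(volume : Measure (Space N)), DifferentiableAt ℝ u (x - t) :=
      (quasiMeasurePreserving_sub_left volume x).ae hu.ae_differentiableAt
    filter_upwards [h1] with t ht
    have h2 := ht.hasFDerivAt.comp x ((hasFDerivAt_id x).sub_const t)
    exact h2.const_smul (b.normed volume t)

theorem norm_fderiv_mollify_le (b : ContDiffBump (0 : Space N)) {u : Space N → ℝ} {K C : ℝ≥0}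
    (hu : LipschitzWith K u) (hC : ∀ᵐ x, ‖fderiv ℝ u x‖ ≤ C) (x : Space N) :
    ‖fderiv ℝ (mollify b u) x‖ ≤ C := by
  rw [(hasFDerivAt_mollify b hu x).fderiv]
  have hb : Integrable (b.normed (volume : Measure (Space N))) volume :=
    b.continuous_normed.integrable_of_hasCompactSupport b.hasCompactSupport_normed
  have h1 : ∀ᵐ t ∂(volume : Measure (Space N)), ‖fderiv ℝ u (x - t)‖ ≤ C :=
    (quasiMeasurePreserving_sub_left volume x).ae hC
  calc _ ≤ ∫ t, b.normed volume t * C := by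
        refine norm_integral_le_of_norm_le (hb.mul_const _) ?_
        filter_upwards [h1] with t ht
        rw [ContinuousLinearMap.lsmul_apply, norm_smul, Real.norm_of_nonneg (b.nonneg_normed t)]
        exact mul_le_mul_of_nonneg_left ht (b.nonneg_normed t)
    _ = C := by rw [integral_mul_const, b.integral_normed, one_mul]

/-- A sequence of bump functions with radii tending to `0`. -/
noncomputable def bumpSeq (N n : ℕ) : ContDiffBump (0 : Space N) where
  rIn := 1 / ((n : ℝ) + 1)
  rOut := 2 / ((n : ℝ) + 1)
  rIn_pos := by positivity
  rIn_lt_rOut := by gcongr; norm_num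

theorem tendsto_bumpSeq_rOut (N : ℕ) :
    Tendsto (fun n => (bumpSeq N n).rOut) atTop (𝓝 0) := by
  have h := (tendsto_one_div_add_atTop_nhds_zero_nat (𝕜 := ℝ)).const_mul 2
  simpa [bumpSeq, div_eq_mul_inv] using h

theorem tendsto_mollify {u : Space N → ℝ} (hu : Continuous u) (x : Space N) :
    Tendsto (fun n => mollify (bumpSeq N n) u x) atTop (𝓝 (u x)) :=
  ContDiffBump.convolution_tendsto_right_of_continuous (tendsto_bumpSeq_rOut N) hu x

theorem ae_tendsto_fderiv_mollify {u : Space N → ℝ} {K : ℝ≥0} (hu : LipschitzWith K u) :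
    ∀ᵐ x, Tendsto (fun n => fderiv ℝ (mollify (bumpSeq N n) u) x) atTop (𝓝 (fderiv ℝ u x)) := by
  have hli : LocallyIntegrable (fderiv ℝ u) (volume : Measure (Space N)) :=
    (memLp_top_of_bound (measurable_fderiv ℝ u).aestronglyMeasurable K
      (Eventually.of_forall fun x => norm_fderiv_le_of_lipschitz ℝ hu)).locallyIntegrable le_top
  -- Lebesgue differentiation needs the outer radius to be at most a fixed multiple of the inner
  -- one; for `bumpSeq` the ratio is 2.
  have h := ContDiffBump.ae_convolution_tendsto_right_of_locallyIntegrable (K := 2)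
    (tendsto_bumpSeq_rOut N) (Eventually.of_forall fun n => by
      simp only [bumpSeq]; rw [mul_one_div]) hli
  filter_upwards [h] with x hx
  refine hx.congr fun n => ?_
  rw [(hasFDerivAt_mollify _ hu x).fderiv]

/-- The Lipschitz constant of a Lipschitz function is bounded by the essential supremum of its
gradient. -/
theorem lipschitzWith_of_ae_norm_fderiv_le {u : Space N → ℝ} {K C : ℝ≥0} (hu : LipschitzWith K u)
    (hC : ∀ᵐ x, ‖fderiv ℝ u x‖ ≤ C) : LipschitzWith C u := by
  refine LipschitzWith.of_dist_le_mul fun x y => ?_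
  -- The mollifications have derivative bounded by `C` at every point, so the mean value inequality
  -- applies to them; the Lipschitz bound survives the pointwise limit.
  refine le_of_tendsto ((tendsto_mollify hu.continuous x).dist (tendsto_mollify hu.continuous y))
    (Eventually.of_forall fun n => ?_)
  have h1 : LipschitzWith C (mollify (bumpSeq N n) u) :=
    lipschitzWith_of_nnnorm_fderiv_le (𝕜 := ℝ)
      ((mollify_contDiff _ hu.continuous).differentiable (by simp)) fun z => by
        exact_mod_cast norm_fderiv_mollify_le _ hu hC z
  exact h1.dist_le_mul x y

theorem cauchy_eLpNorm_gradient {G : Space N → Space N} {v : ℕ → Space N → ℝ}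
    (hG : AEStronglyMeasurable G volume)
    (h : Tendsto (fun n => eLpNorm (fun x => ∇ (v n) x - G x) 2 volume) atTop (𝓝 0))
    (ε : ℝ≥0∞) (hε : 0 < ε) : ∃ n₀ : ℕ, ∀ m ≥ n₀, ∀ n ≥ n₀,
      eLpNorm (fun x => ∇ (v m) x - ∇ (v n) x) 2 volume < ε := by
  have h3 := h.eventually (gt_mem_nhds (ENNReal.half_pos hε.ne'))
  obtain ⟨n₀, hn₀⟩ := eventually_atTop.1 h3
  refine ⟨n₀, fun m hm n hn => ?_⟩
  have hmeas : ∀ k, AEStronglyMeasurable (fun x => ∇ (v k) x - G x) volume := fun k =>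
    (measurable_gradient (v k)).aestronglyMeasurable.sub hG
  calc eLpNorm (fun x => ∇ (v m) x - ∇ (v n) x) 2 volume
      = eLpNorm ((fun x => ∇ (v m) x - G x) - fun x => ∇ (v n) x - G x) 2 volume := by
        congr 1; ext1 x; simp
    _ ≤ _ := eLpNorm_sub_le (hmeas m) (hmeas n) (by norm_num)
    _ < ε / 2 + ε / 2 := ENNReal.add_lt_add (hn₀ m hm) (hn₀ n hn)
    _ = ε := ENNReal.add_halves ε

theorem memD12_of_tendsto {u : Space N → ℝ} {G : Space N → Space N} {v : ℕ → Space N → ℝ}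
    (hv : ∀ n, IsTest (v n)) (hG : AEStronglyMeasurable G volume)
    (h1 : Tendsto (fun n => eLpNorm (fun x => ∇ (v n) x - G x) 2 volume) atTop (𝓝 0))
    (h2 : Tendsto (fun n => eLpNorm (fun x => v n x - u x) (sobolevExp N) volume) atTop (𝓝 0)) :
    MemD12 u :=
  ⟨v, hv, cauchy_eLpNorm_gradient hG h1, h2⟩

theorem sobolevExp_ne_zero (hN : 3 ≤ N) : sobolevExp N ≠ 0 := by
  have : (3 : ℝ) ≤ N := by exact_mod_cast hN
  rw [sobolevExp, Ne, ENNReal.ofReal_eq_zero, not_le]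
  exact div_pos (by linarith) (by linarith)

theorem one_le_sobolevExp (hN : 3 ≤ N) : 1 ≤ sobolevExp N := by
  have : (3 : ℝ) ≤ N := by exact_mod_cast hN
  rw [sobolevExp, ENNReal.one_le_ofReal, le_div_iff₀ (by linarith)]
  linarith

theorem sobolevExp_ne_top : sobolevExp N ≠ ⊤ := ENNReal.ofReal_ne_top

theorem support_mollify_subset {u : Space N → ℝ} {R : ℝ}
    (hR : Function.support u ⊆ Metric.closedBall 0 R) (n : ℕ) : Function.support (mollify (bumpSeq N n) u) ⊆ Metric.closedBall 0 (R + 2) := by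
  refine (support_convolution_subset _).trans ?_
  rw [ContDiffBump.support_normed_eq]
  rintro _ ⟨y, hy, z, hz, rfl⟩
  have h1 : ‖y‖ < 2 / ((n : ℝ) + 1) := by simpa [bumpSeq] using hy
  have h2 : ‖z‖ ≤ R := by simpa using hR hz
  have h3 : 2 / ((n : ℝ) + 1) ≤ 2 :=
    div_le_self (by norm_num) (by linarith [n.cast_nonneg (α := ℝ)])
  have := norm_add_le y z
  simp only [Metric.mem_closedBall, dist_zero_right]
  linarith

/-- The mollifications are test functions that converge, with their gradients, almost everywhere.
All differences are dominated by a constant on the ball of radius `R + 2`, as every bump has outer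
radius at most 2. -/
theorem memD12_of_hasCompactSupport (hN : 3 ≤ N) {u : Space N → ℝ} {K : ℝ≥0}
    (hu : LipschitzWith K u) (hs : HasCompactSupport u) : MemD12 u := by
  obtain ⟨R, hR⟩ : ∃ R, Function.support u ⊆ Metric.closedBall 0 R := by
    obtain ⟨R, hR⟩ := hs.isCompact.isBounded.subset_closedBall 0
    exact ⟨R, (subset_tsupport u).trans hR⟩
  have hind : ∀ (c : ℝ) (p : ℝ≥0∞), MemLp
      ((Metric.closedBall (0 : Space N) (R + 2)).indicator fun _ => c) p volume := fun c p =>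
    memLp_indicator_const p measurableSet_closedBall c
      (Or.inr measure_closedBall_lt_top.ne)
  have hlip : ∀ n, LipschitzWith K (mollify (bumpSeq N n) u) := fun n =>
    lipschitzWith_of_nnnorm_fderiv_le (𝕜 := ℝ)
      ((mollify_contDiff _ hu.continuous).differentiable (by simp)) fun z => by
        exact_mod_cast norm_fderiv_mollify_le _ hu
          (Eventually.of_forall fun x => norm_fderiv_le_of_lipschitz ℝ hu) z
  have hout : ∀ x ∉ Metric.closedBall (0 : Space N) (R + 2),
      u x = 0 ∧ ∀ n, mollify (bumpSeq N n) u x = 0 := fun x hx =>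
    ⟨by_contra fun h => hx (Metric.closedBall_subset_closedBall (by linarith) (hR h)),
      fun n => by_contra fun h => hx (support_mollify_subset hR n h)⟩
  have hopen : IsOpen (Metric.closedBall (0 : Space N) (R + 2))ᶜ :=
    Metric.isClosed_closedBall.isOpen_compl
  refine memD12_of_tendsto (v := fun n => mollify (bumpSeq N n) u) (G := ∇ u)
    (fun n => ⟨mollify_contDiff _ hu.continuous, mollify_hasCompactSupport _ hs⟩)
    (measurable_gradient u).aestronglyMeasurable ?_ ?_
  · refine tendsto_eLpNorm_sub_of_dominated (by norm_num) (by norm_num)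
      (fun n => (measurable_gradient _).aestronglyMeasurable)
      (measurable_gradient _).aestronglyMeasurable (hind (K + K) 2) (fun n => ?_) ?_
    · refine Eventually.of_forall fun x => ?_
      by_cases hx : x ∈ Metric.closedBall (0 : Space N) (R + 2)
      · rw [Set.indicator_of_mem hx]
        refine (norm_sub_le _ _).trans ?_
        rw [norm_gradient, norm_gradient]
        exact add_le_add (norm_fderiv_le_of_lipschitz ℝ (hlip n)) (norm_fderiv_le_of_lipschitz ℝ hu)
      · rw [Set.indicator_of_notMem hx, norm_gradient_sub]
        have h1 : mollify (bumpSeq N n) u =ᶠ[𝓝 x] u := by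
          filter_upwards [hopen.mem_nhds hx] with y hy
          rw [(hout y hy).1, (hout y hy).2]
        rw [h1.fderiv_eq, sub_self, norm_zero]
    · filter_upwards [ae_tendsto_fderiv_mollify hu] with x hx
      exact ((InnerProductSpace.toDual ℝ (Space N)).symm.continuous.tendsto _).comp hx
  · refine tendsto_eLpNorm_sub_of_dominated (sobolevExp_ne_zero hN) sobolevExp_ne_top
      (fun n => (hlip n).continuous.aestronglyMeasurable) hu.continuous.aestronglyMeasurable
      (hind (K * 2) _) (fun n => ?_) (Eventually.of_forall fun x => tendsto_mollify hu.continuous x)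
    refine Eventually.of_forall fun x => ?_
    by_cases hx : x ∈ Metric.closedBall (0 : Space N) (R + 2)
    · rw [Set.indicator_of_mem hx, ← dist_eq_norm]
      refine ContDiffBump.dist_normed_convolution_le hu.continuous.aestronglyMeasurable
        fun y hy => (hu.dist_le_mul y x).trans ?_
      gcongr
      have h3 : 2 / ((n : ℝ) + 1) ≤ 2 :=
        div_le_self (by norm_num) (by linarith [n.cast_nonneg (α := ℝ)])
      exact (Metric.mem_ball.1 hy).le.trans h3
    · rw [Set.indicator_of_notMem hx, (hout x hx).1, (hout x hx).2, sub_zero, norm_zero]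

end Mollify

/-! ### Limits in `L^p` -/

section Lp

variable {α F : Type*} [MeasurableSpace α] {μ : Measure α} [NormedAddCommGroup F] {p : ℝ≥0∞}

theorem exists_tendsto_eLpNorm_of_cauchy [CompleteSpace F] (hp : 1 ≤ p) {f : ℕ → α → F}
    (hf : ∀ n, MemLp (f n) p μ)
    (hc : ∀ ε : ℝ≥0∞, 0 < ε → ∃ n₀ : ℕ, ∀ m ≥ n₀, ∀ n ≥ n₀,
      eLpNorm (fun x => f m x - f n x) p μ < ε) :
    ∃ g, MemLp g p μ ∧ Tendsto (fun n => eLpNorm (fun x => f n x - g x) p μ) atTop (𝓝 0) := by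
  have : Fact (1 ≤ p) := ⟨hp⟩
  have h1 : CauchySeq fun n => (hf n).toLp (f n) := by
    rw [EMetric.cauchySeq_iff]
    intro ε hε
    obtain ⟨n₀, h⟩ := hc ε hε
    refine ⟨n₀, fun m hm n hn => ?_⟩
    rw [Lp.edist_toLp_toLp]
    exact h m hm n hn
  obtain ⟨g, hg⟩ := cauchySeq_tendsto_of_complete h1
  refine ⟨g, Lp.memLp g, ?_⟩
  have h2 := (Lp.tendsto_Lp_iff_tendsto_eLpNorm' _ _).1 hg
  refine h2.congr fun n => eLpNorm_congr_ae ?_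
  filter_upwards [(hf n).coeFn_toLp] with x hx
  simp [hx]

theorem tendsto_integral_smul_of_tendsto_eLpNorm [NormedSpace ℝ F] {q : ℝ≥0∞}
    [ENNReal.HolderTriple q p 1] {w : α → ℝ} {f : ℕ → α → F} {g : α → F}
    (hw : MemLp w q μ) (hf : ∀ n, AEStronglyMeasurable (f n) μ) (hg : AEStronglyMeasurable g μ)
    (hint : ∀ n, Integrable (fun x => w x • f n x) μ)
    (h : Tendsto (fun n => eLpNorm (fun x => f n x - g x) p μ) atTop (𝓝 0)) :
    Tendsto (fun n => ∫ x, w x • f n x ∂μ) atTop (𝓝 (∫ x, w x • g x ∂μ)) := by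
  refine tendsto_integral_of_L1' _ (hw.aestronglyMeasurable.smul hg) (Eventually.of_forall hint) ?_
  have h1 : Tendsto (fun n => eLpNorm w q μ * eLpNorm (fun x => f n x - g x) p μ) atTop (𝓝 0) := by
    have := ENNReal.Tendsto.const_mul (a := eLpNorm w q μ) h (Or.inr hw.2.ne)
    simpa using this
  refine tendsto_of_tendsto_of_tendsto_of_le_of_le tendsto_const_nhds h1 (fun _ => zero_le)
    fun n => ?_
  refine le_trans (le_of_eq ?_) (eLpNorm_smul_le_mul_eLpNorm (p := q) (q := p) (r := 1)
    ((hf n).sub hg) hw.aestronglyMeasurable)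
  congr 1
  ext1 x
  simp [smul_sub]

theorem tendsto_eLpNorm_smul_zero [NormedSpace ℝ F] (c : ℝ) {f : ℕ → α → F}
    (h : Tendsto (fun n => eLpNorm (f n) p μ) atTop (𝓝 0)) :
    Tendsto (fun n => eLpNorm (fun x => c • f n x) p μ) atTop (𝓝 0) := by
  have h1 := ENNReal.Tendsto.const_mul (a := ‖c‖ₑ) h (Or.inr enorm_ne_top)
  rw [mul_zero] at h1
  exact h1.congr fun n => (eLpNorm_const_smul c (f n) p μ).symm

theorem tendsto_eLpNorm_add_zero (hp : 1 ≤ p) {f g : ℕ → α → F}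
    (hf : ∀ n, AEStronglyMeasurable (f n) μ) (hg : ∀ n, AEStronglyMeasurable (g n) μ)
    (h1 : Tendsto (fun n => eLpNorm (f n) p μ) atTop (𝓝 0))
    (h2 : Tendsto (fun n => eLpNorm (g n) p μ) atTop (𝓝 0)) :
    Tendsto (fun n => eLpNorm (fun x => f n x + g n x) p μ) atTop (𝓝 0) := by
  have h3 := h1.add h2
  rw [add_zero] at h3
  exact tendsto_of_tendsto_of_tendsto_of_le_of_le tendsto_const_nhds h3 (fun _ => zero_le)
    fun n => eLpNorm_add_le (hf n) (hg n) hp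

end Lp

/-! ### Weak gradients in `D^{1,2}` and the Sobolev inequality -/

variable {N : ℕ}

theorem IsTest.memLp {v : Space N → ℝ} (hv : IsTest v) (p : ℝ≥0∞) : MemLp v p volume :=
  hv.1.continuous.memLp_of_hasCompactSupport hv.2

theorem IsTest.memLp_gradient {v : Space N → ℝ} (hv : IsTest v) (p : ℝ≥0∞) :
    MemLp (∇ v) p volume := by
  have h : MemLp (fderiv ℝ v) p volume :=
    (hv.1.continuous_fderiv (by simp)).memLp_of_hasCompactSupport (hv.2.fderiv ℝ)
  exact h.of_le (measurable_gradient v).aestronglyMeasurable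
    (Eventually.of_forall fun x => (norm_gradient v x).le)

theorem IsTest.lincomb {v w : Space N → ℝ} (hv : IsTest v) (hw : IsTest w) (a b : ℝ) :
    IsTest (a • v + b • w) := by
  refine ⟨(hv.1.const_smul a).add (hw.1.const_smul b), HasCompactSupport.add ?_ ?_⟩
  · exact hv.2.comp_left (g := fun t => a * t) (mul_zero a)
  · exact hw.2.comp_left (g := fun t => b * t) (mul_zero b)

theorem IsTest.exists_lipschitzWith {v : Space N → ℝ} (hv : IsTest v) :
    ∃ K, LipschitzWith K v :=
  hv.1.lipschitzWith_of_hasCompactSupport hv.2 (by simp)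

/-- Integration by parts of a Lipschitz function against a test function. -/
theorem integral_smul_inner_gradient {u w : Space N → ℝ} {K : ℝ≥0} (hu : LipschitzWith K u)
    (hw : IsTest w) (e : Space N) :
    ∫ x, w x • inner ℝ (∇ u x) e = ∫ x, (fderiv ℝ w x (-e)) • u x := by
  obtain ⟨L, hL⟩ := hw.exists_lipschitzWith
  have h := hu.integral_lineDeriv_mul_eq (μ := volume) hL hw.2 e
  calc _ = ∫ x, lineDeriv ℝ u x e * w x := by
        refine integral_congr_ae ?_
        filter_upwards [hu.ae_differentiableAt] with x hx
        rw [hx.lineDeriv_eq_fderiv, inner_gradient_left, smul_eq_mul, mul_comm]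
    _ = _ := h
    _ = _ := by
        refine integral_congr_ae (Eventually.of_forall fun x => ?_)
        simp only [smul_eq_mul]
        rw [((hw.1.differentiable (by simp)) x).lineDeriv_eq_fderiv]

/-- The gradients have some `L²` limit `G`. Integrating `∇ (v n)` by parts against a test function
and passing to the limit, by `L²` convergence on one side and `L^{2*}` convergence on the other,
shows that `G` is the weak gradient of `u`. So is `∇ u`, because `u` is Lipschitz, and the two agree
almost everywhere. -/
theorem tendsto_gradient {u : Space N → ℝ} {K : ℝ≥0} (hN : 3 ≤ N) (hu : LipschitzWith K u)
    {v : ℕ → Space N → ℝ} (hv : ∀ n, IsTest (v n))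
    (hc : ∀ ε : ℝ≥0∞, 0 < ε → ∃ n₀ : ℕ, ∀ m ≥ n₀, ∀ n ≥ n₀,
      eLpNorm (fun x => ∇ (v m) x - ∇ (v n) x) 2 volume < ε)
    (hlim : Tendsto (fun n => eLpNorm (fun x => v n x - u x) (sobolevExp N) volume) atTop (𝓝 0)) :
    MemLp (∇ u) 2 volume ∧
      Tendsto (fun n => eLpNorm (fun x => ∇ (v n) x - ∇ u x) 2 volume) atTop (𝓝 0) := by
  obtain ⟨G, hG, hGlim⟩ := exists_tendsto_eLpNorm_of_cauchy (by norm_num)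
    (fun n => (hv n).memLp_gradient 2) hc
  have hcoord : ∀ e : Space N, ∀ᵐ x, inner ℝ (G x) e = inner ℝ (∇ u x) e := by
    intro e
    have hGe : MemLp (fun x => inner ℝ (G x) e) 2 volume := hG.inner_const e
    refine ae_eq_of_integral_contDiff_smul_eq (hGe.locallyIntegrable (by norm_num)) ?_ ?_
    · refine (memLp_top_of_bound (C := K * ‖e‖) ?_ ?_).locallyIntegrable le_top
      · exact ((measurable_gradient u).inner measurable_const).aestronglyMeasurable
      · refine Eventually.of_forall fun x => (norm_inner_le_norm _ _).trans ?_
        rw [norm_gradient]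
        gcongr
        exact norm_fderiv_le_of_lipschitz ℝ hu
    · intro w hw hws
      have hwt : IsTest w := ⟨hw, hws⟩
      have hdw : Continuous fun x => fderiv ℝ w x (-e) :=
        (hw.continuous_fderiv (by simp)).clm_apply continuous_const
      have hdws : HasCompactSupport fun x => fderiv ℝ w x (-e) :=
        hws.fderiv_apply ℝ (-e)
      rw [integral_smul_inner_gradient hu hwt e]
      have h1 : Tendsto (fun n => ∫ x, w x • inner ℝ (∇ (v n) x) e) atTop
          (𝓝 (∫ x, w x • inner ℝ (G x) e)) := by
        refine tendsto_integral_smul_of_tendsto_eLpNorm (p := 2) (q := 2) (hwt.memLp 2)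
          (fun n => ((hv n).memLp_gradient 2 |>.inner_const e).aestronglyMeasurable)
          hGe.aestronglyMeasurable
          (fun n => (hwt.memLp 2).integrable_mul (((hv n).memLp_gradient 2).inner_const e)) ?_
        have h2 : Tendsto (fun n => ENNReal.ofReal ‖e‖ *
            eLpNorm (fun x => ∇ (v n) x - G x) 2 volume) atTop (𝓝 0) := by
          have := ENNReal.Tendsto.const_mul (a := ENNReal.ofReal ‖e‖) hGlim
            (Or.inr ENNReal.ofReal_ne_top)
          simpa using this
        refine tendsto_of_tendsto_of_tendsto_of_le_of_le tendsto_const_nhds h2 (fun _ => zero_le)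
          fun n => eLpNorm_le_mul_eLpNorm_of_ae_le_mul (Eventually.of_forall fun x => ?_) 2
        rw [← inner_sub_left, mul_comm]
        exact norm_inner_le_norm _ _
      have : ENNReal.HolderConjugate (sobolevExp N) (sobolevExp N).conjExponent :=
        ENNReal.HolderConjugate.conjExponent (one_le_sobolevExp hN)
      have h3 : Tendsto (fun n => ∫ x, fderiv ℝ w x (-e) • v n x) atTop
          (𝓝 (∫ x, fderiv ℝ w x (-e) • u x)) := by
        refine tendsto_integral_smul_of_tendsto_eLpNorm (p := sobolevExp N)
          (q := (sobolevExp N).conjExponent) (hdw.memLp_of_hasCompactSupport hdws)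
          (fun n => (hv n).1.continuous.aestronglyMeasurable) hu.continuous.aestronglyMeasurable
          (fun n => ?_) hlim
        exact (hdw.smul (hv n).1.continuous).integrable_of_hasCompactSupport hdws.smul_right
      refine tendsto_nhds_unique (h1.congr fun n => ?_) h3
      obtain ⟨L, hL⟩ := (hv n).exists_lipschitzWith
      exact integral_smul_inner_gradient hL hwt e
  have hae : G =ᵐ[volume] ∇ u := by
    have h1 : ∀ᵐ x, ∀ i, inner ℝ (G x) (EuclideanSpace.basisFun (Fin N) ℝ i) =
        inner ℝ (∇ u x) (EuclideanSpace.basisFun (Fin N) ℝ i) :=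
      ae_all_iff.2 fun i => hcoord _
    filter_upwards [h1] with x hx
    ext i
    have h2 := hx i
    rw [EuclideanSpace.basisFun_apply, EuclideanSpace.inner_single_right,
      EuclideanSpace.inner_single_right] at h2
    simpa using h2
  refine ⟨hG.ae_eq hae, hGlim.congr fun n => eLpNorm_congr_ae ?_⟩
  filter_upwards [hae] with x hx
  rw [hx]

/-- The Sobolev inequality for test functions. -/
theorem exists_sobolev_test (hN : 3 ≤ N) : ∃ C : ℝ≥0, ∀ v : Space N → ℝ, IsTest v →
    eLpNorm v (sobolevExp N) volume ≤ C * eLpNorm (∇ v) 2 volume := by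
  refine ⟨SNormLESNormFDerivOfEqConst ℝ (volume : Measure (Space N)) 2, fun v hv => ?_⟩
  have hN' : (3 : ℝ) ≤ N := by exact_mod_cast hN
  have h := eLpNorm_le_eLpNorm_fderiv_of_eq (volume : Measure (Space N)) (F := ℝ) (u := v)
    (p := 2) (p' := Real.toNNReal (2 * (N : ℝ) / ((N : ℝ) - 2)))
    (hv.1.of_le (by exact_mod_cast le_top)) hv.2 (by norm_num) (by simp; omega) (by
      rw [Real.coe_toNNReal _ (div_nonneg (by linarith) (by linarith))]
      have h2 : (N : ℝ) - 2 ≠ 0 := by linarith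
      simp
      field_simp)
  refine h.trans (le_of_eq ?_)
  congr 1
  exact eLpNorm_congr_norm_ae (Eventually.of_forall fun x => (norm_gradient v x).symm)

/-! ### Linear structure and the norm of `𝒳` -/

section Structure

variable {u u' : Space N → ℝ} {K K' : ℝ≥0}

theorem MemD12.memLp_gradient (hN : 3 ≤ N) (hu : MemD12 u) (hK : LipschitzWith K u) :
    MemLp (∇ u) 2 volume := by
  obtain ⟨v, hv, hc, hlim⟩ := hu
  exact (tendsto_gradient hN hK hv hc hlim).1

theorem MemD12.exists_seq (hN : 3 ≤ N) (hu : MemD12 u) (hK : LipschitzWith K u) :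
    ∃ v : ℕ → Space N → ℝ, (∀ n, IsTest (v n)) ∧
      Tendsto (fun n => eLpNorm (fun x => ∇ (v n) x - ∇ u x) 2 volume) atTop (𝓝 0) ∧
      Tendsto (fun n => eLpNorm (fun x => v n x - u x) (sobolevExp N) volume) atTop (𝓝 0) := by
  obtain ⟨v, hv, hc, hlim⟩ := hu
  exact ⟨v, hv, (tendsto_gradient hN hK hv hc hlim).2, hlim⟩

theorem exists_sobolev (hN : 3 ≤ N) : ∃ C : ℝ≥0, ∀ (u : Space N → ℝ) (K : ℝ≥0), MemD12 u →
    LipschitzWith K u → eLpNorm u (sobolevExp N) volume ≤ C * eLpNorm (∇ u) 2 volume := by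
  obtain ⟨C, hC⟩ := exists_sobolev_test hN
  refine ⟨C, fun u K hu hK => ?_⟩
  obtain ⟨v, hv, h1, h2⟩ := hu.exists_seq hN hK
  have h3 : Tendsto (fun n => eLpNorm (fun x => v n x - u x) (sobolevExp N) volume +
      C * (eLpNorm (fun x => ∇ (v n) x - ∇ u x) 2 volume + eLpNorm (∇ u) 2 volume)) atTop
      (𝓝 (0 + C * (0 + eLpNorm (∇ u) 2 volume))) :=
    h2.add (ENNReal.Tendsto.const_mul (h1.add tendsto_const_nhds) (Or.inr ENNReal.coe_ne_top))
  rw [zero_add, zero_add] at h3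
  refine ge_of_tendsto' h3 fun n => ?_
  calc eLpNorm u (sobolevExp N) volume
      = eLpNorm (v n - fun x => v n x - u x) (sobolevExp N) volume := by
        congr 1; ext1 x; simp
    _ ≤ eLpNorm (v n) (sobolevExp N) volume +
        eLpNorm (fun x => v n x - u x) (sobolevExp N) volume :=
      eLpNorm_sub_le (hv n).1.continuous.aestronglyMeasurable
        ((hv n).1.continuous.sub hK.continuous).aestronglyMeasurable (one_le_sobolevExp hN)
    _ ≤ C * eLpNorm (∇ (v n)) 2 volume +
        eLpNorm (fun x => v n x - u x) (sobolevExp N) volume := by gcongr; exact hC _ (hv n)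
    _ ≤ C * (eLpNorm (fun x => ∇ (v n) x - ∇ u x) 2 volume + eLpNorm (∇ u) 2 volume) +
        eLpNorm (fun x => v n x - u x) (sobolevExp N) volume := by
      gcongr
      calc eLpNorm (∇ (v n)) 2 volume
          = eLpNorm ((fun x => ∇ (v n) x - ∇ u x) + ∇ u) 2 volume := by
            congr 1; ext1 x; simp
        _ ≤ _ := eLpNorm_add_le ((measurable_gradient _).sub
            (measurable_gradient _)).aestronglyMeasurable
            (measurable_gradient _).aestronglyMeasurable (by norm_num)
    _ = _ := add_comm _ _

theorem lipschitzWith_lincomb (hK : LipschitzWith K u) (hK' : LipschitzWith K' u') (a b : ℝ) :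
    LipschitzWith (‖a‖₊ * K + ‖b‖₊ * K') (a • u + b • u') :=
  ((lipschitzWith_smul a).comp hK).add ((lipschitzWith_smul b).comp hK')

theorem MemD12.lincomb (hN : 3 ≤ N) (hu : MemD12 u) (hK : LipschitzWith K u) (hu' : MemD12 u')
    (hK' : LipschitzWith K' u') (a b : ℝ) : MemD12 (a • u + b • u') := by
  obtain ⟨v, hv, h1, h2⟩ := hu.exists_seq hN hK
  obtain ⟨v', hv', h1', h2'⟩ := hu'.exists_seq hN hK'
  refine memD12_of_tendsto (v := fun n => a • v n + b • v' n)
    (G := fun x => a • ∇ u x + b • ∇ u' x) (fun n => (hv n).lincomb (hv' n) a b)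
    (((measurable_gradient u).const_smul a).add
      ((measurable_gradient u').const_smul b)).aestronglyMeasurable ?_ ?_
  · have h3 : Tendsto (fun n => eLpNorm (fun x => a • (∇ (v n) x - ∇ u x) +
        b • (∇ (v' n) x - ∇ u' x)) 2 volume) atTop (𝓝 0) := by
      refine tendsto_eLpNorm_add_zero (by norm_num) (fun n => ?_) (fun n => ?_) ?_ ?_
      · exact (((measurable_gradient _).sub (measurable_gradient _)).const_smul
          a).aestronglyMeasurable
      · exact (((measurable_gradient _).sub (measurable_gradient _)).const_smul
          b).aestronglyMeasurable
      · exact tendsto_eLpNorm_smul_zero a h1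
      · exact tendsto_eLpNorm_smul_zero b h1'
    refine h3.congr fun n => ?_
    congr 1
    ext1 x
    rw [gradient_lincomb ((hv n).1.differentiable (by simp) x)
      ((hv' n).1.differentiable (by simp) x)]
    module
  · have h3 : Tendsto (fun n => eLpNorm (fun x => a • (v n x - u x) +
        b • (v' n x - u' x)) (sobolevExp N) volume) atTop (𝓝 0) := by
      refine tendsto_eLpNorm_add_zero (one_le_sobolevExp hN) (fun n => ?_) (fun n => ?_) ?_ ?_
      · exact (((hv n).1.continuous.sub hK.continuous).const_smul a).aestronglyMeasurable
      · exact (((hv' n).1.continuous.sub hK'.continuous).const_smul b).aestronglyMeasurable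
      · exact tendsto_eLpNorm_smul_zero a h2
      · exact tendsto_eLpNorm_smul_zero b h2'
    refine h3.congr fun n => ?_
    congr 1
    ext1 x
    simp only [Pi.add_apply, Pi.smul_apply, smul_eq_mul]
    ring

/-- Square integrability matters: without it the Bochner integral in `xNorm` takes the default value
0 while the right side is infinite. -/
theorem xNorm_eq (h : MemLp (∇ u) 2 volume) :
    ENNReal.ofReal (xNorm u) = eLpNorm (∇ u) 2 volume := by
  rw [h.eLpNorm_eq_integral_rpow_norm (by norm_num) (by norm_num), xNorm, Real.sqrt_eq_rpow]
  simp

theorem xNorm_nonneg : 0 ≤ xNorm u := Real.sqrt_nonneg _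

theorem xNorm_sq : xNorm u ^ 2 = ∫ x, ‖∇ u x‖ ^ 2 :=
  Real.sq_sqrt (integral_nonneg fun x => by positivity)

end Structure

/-! ### `𝒳` as a complete metric space -/

namespace X

theorem memD12 (φ : X N) : MemD12 φ.1 := φ.2.1

theorem ae_norm_gradient_le (φ : X N) : ∀ᵐ x, ‖∇ φ.1 x‖ ≤ 1 := φ.2.2.2

theorem lipschitzWith (φ : X N) : LipschitzWith 1 φ.1 := by
  obtain ⟨K, hK⟩ := φ.2.2.1
  refine lipschitzWith_of_ae_norm_fderiv_le hK ?_
  filter_upwards [X.ae_norm_gradient_le φ] with x hx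
  rwa [norm_gradient] at hx

theorem memLp_gradient (hN : 3 ≤ N) (φ : X N) : MemLp (∇ φ.1) 2 volume :=
  (X.memD12 φ).memLp_gradient hN (X.lipschitzWith φ)

theorem integrable_norm_sq (hN : 3 ≤ N) (φ : X N) : Integrable (fun x => ‖∇ φ.1 x‖ ^ 2) volume :=
  (memLp_two_iff_integrable_sq_norm (X.memLp_gradient hN φ).1).1 (X.memLp_gradient hN φ)

theorem ae_gradient_lincomb (φ ψ : X N) (a b : ℝ) :
    ∀ᵐ x, ∇ (a • φ.1 + b • ψ.1) x = a • ∇ φ.1 x + b • ∇ ψ.1 x :=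
  BornInfeld.ae_gradient_lincomb (X.lipschitzWith φ) (X.lipschitzWith ψ) a b

theorem ae_gradient_sub (φ ψ : X N) :
    ∀ᵐ x, ∇ (φ.1 - ψ.1) x = ∇ φ.1 x - ∇ ψ.1 x := by
  filter_upwards [X.ae_gradient_lincomb φ ψ 1 (-1)] with x hx
  have h : φ.1 - ψ.1 = (1 : ℝ) • φ.1 + (-1 : ℝ) • ψ.1 := by module
  rw [h, hx]
  module

/-- Asking for the bound pointwise, instead of `|a| + |b| ≤ 1`, admits perturbations `φ + tη` in
which `∇η` vanishes where `|∇φ|` is close to 1. -/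
theorem lincomb_mem (hN : 3 ≤ N) (φ ψ : X N) {a b : ℝ}
    (h : ∀ᵐ x, ‖a • ∇ φ.1 x + b • ∇ ψ.1 x‖ ≤ 1) : a • φ.1 + b • ψ.1 ∈ X N := by
  refine ⟨(X.memD12 φ).lincomb hN (X.lipschitzWith φ) (X.memD12 ψ) (X.lipschitzWith ψ) a b,
    ⟨_, lipschitzWith_lincomb (X.lipschitzWith φ) (X.lipschitzWith ψ) a b⟩, ?_⟩
  filter_upwards [h, X.ae_gradient_lincomb φ ψ a b] with x hx hx'
  rwa [hx']

theorem lincomb_mem_of_abs_add_abs_le (hN : 3 ≤ N) (φ ψ : X N) {a b : ℝ} (h : |a| + |b| ≤ 1) :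
    a • φ.1 + b • ψ.1 ∈ X N := by
  refine lincomb_mem hN φ ψ ?_
  filter_upwards [(X.ae_norm_gradient_le φ), (X.ae_norm_gradient_le ψ)] with x hx hx'
  calc _ ≤ ‖a • ∇ φ.1 x‖ + ‖b • ∇ ψ.1 x‖ := norm_add_le _ _
    _ = |a| * ‖∇ φ.1 x‖ + |b| * ‖∇ ψ.1 x‖ := by rw [norm_smul, norm_smul]; rfl
    _ ≤ |a| * 1 + |b| * 1 := by gcongr
    _ ≤ 1 := by linarith

theorem eLpNorm_gradient_sub (hN : 3 ≤ N) (φ ψ : X N) :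
    eLpNorm (fun x => ∇ φ.1 x - ∇ ψ.1 x) 2 volume = ENNReal.ofReal (xNorm (φ.1 - ψ.1)) := by
  have h : (fun x => ∇ φ.1 x - ∇ ψ.1 x) =ᵐ[volume] ∇ (φ.1 - ψ.1) := by
    filter_upwards [X.ae_gradient_sub φ ψ] with x hx
    rw [hx]
  rw [xNorm_eq (((X.memLp_gradient hN φ).sub (X.memLp_gradient hN ψ)).ae_eq h)]
  exact eLpNorm_congr_ae h

theorem xNorm_sub_sq (φ ψ : X N) :
    xNorm (φ.1 - ψ.1) ^ 2 = ∫ x, ‖∇ φ.1 x - ∇ ψ.1 x‖ ^ 2 := by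
  rw [xNorm_sq]
  refine integral_congr_ae ?_
  filter_upwards [X.ae_gradient_sub φ ψ] with x hx
  rw [hx]

theorem integrable_norm_sub_sq (hN : 3 ≤ N) (φ ψ : X N) :
    Integrable (fun x => ‖∇ φ.1 x - ∇ ψ.1 x‖ ^ 2) volume :=
  (memLp_two_iff_integrable_sq_norm ((X.memLp_gradient hN φ).sub (X.memLp_gradient hN ψ)).1).1
    ((X.memLp_gradient hN φ).sub (X.memLp_gradient hN ψ))

theorem memD12_sub (hN : 3 ≤ N) (φ ψ : X N) : MemD12 (φ.1 - ψ.1) := by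
  have h : φ.1 - ψ.1 = (1 : ℝ) • φ.1 + (-1 : ℝ) • ψ.1 := by module
  rw [h]
  exact (X.memD12 φ).lincomb hN (X.lipschitzWith φ) (X.memD12 ψ) (X.lipschitzWith ψ) 1 (-1)

theorem eLpNorm_sub_le (hN : 3 ≤ N) : ∃ C : ℝ≥0, ∀ φ ψ : X N,
    eLpNorm (fun x => φ.1 x - ψ.1 x) (sobolevExp N) volume ≤
      C * ENNReal.ofReal (xNorm (φ.1 - ψ.1)) := by
  obtain ⟨C, hC⟩ := exists_sobolev hN
  refine ⟨C, fun φ ψ => ?_⟩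
  have h := hC (φ.1 - ψ.1) _ (X.memD12_sub hN φ ψ) ((X.lipschitzWith φ).sub (X.lipschitzWith ψ))
  refine h.trans (le_of_eq ?_)
  rw [← X.eLpNorm_gradient_sub hN φ ψ]
  congr 1
  refine eLpNorm_congr_ae ?_
  filter_upwards [X.ae_gradient_sub φ ψ] with x hx
  rw [hx]

theorem memLp (hN : 3 ≤ N) (φ : X N) : MemLp φ.1 (sobolevExp N) volume := by
  obtain ⟨C, hC⟩ := exists_sobolev hN
  exact ⟨(X.lipschitzWith φ).continuous.aestronglyMeasurable,
    (hC φ.1 _ (X.memD12 φ) (X.lipschitzWith φ)).trans_lt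
      (ENNReal.mul_lt_top ENNReal.coe_lt_top (X.memLp_gradient hN φ).2)⟩

theorem eq_of_xNorm_sub_eq_zero (hN : 3 ≤ N) {φ ψ : X N} (h : xNorm (φ.1 - ψ.1) = 0) : φ = ψ := by
  obtain ⟨C, hC⟩ := eLpNorm_sub_le hN
  have h1 := hC φ ψ
  rw [h, ENNReal.ofReal_zero, mul_zero, nonpos_iff_eq_zero] at h1
  replace h1 := (eLpNorm_eq_zero_iff (f := fun x => φ.1 x - ψ.1 x)
    ((X.lipschitzWith φ).continuous.sub (X.lipschitzWith ψ).continuous).aestronglyMeasurable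
    (sobolevExp_ne_zero hN)).1 h1
  refine Subtype.ext (Continuous.ae_eq_iff_eq volume (X.lipschitzWith φ).continuous
    (X.lipschitzWith ψ).continuous |>.1 ?_)
  filter_upwards [h1] with x hx
  exact sub_eq_zero.1 hx

theorem exists_subseq_ae_tendsto (hN : 3 ≤ N) {φ : ℕ → X N} {ψ : X N}
    (h : Tendsto (fun n => xNorm ((φ n).1 - ψ.1)) atTop (𝓝 0)) :
    ∃ ns : ℕ → ℕ, StrictMono ns ∧
      ∀ᵐ x, Tendsto (fun n => ∇ (φ (ns n)).1 x) atTop (𝓝 (∇ ψ.1 x)) := by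
  have h1 := (ENNReal.continuous_ofReal.tendsto 0).comp h
  rw [ENNReal.ofReal_zero] at h1
  have h2 : Tendsto (fun n => eLpNorm (fun x => ∇ (φ n).1 x - ∇ ψ.1 x) 2 volume) atTop (𝓝 0) :=
    h1.congr fun n => (X.eLpNorm_gradient_sub hN (φ n) ψ).symm
  exact (tendstoInMeasure_of_tendsto_eLpNorm (p := 2) (by norm_num)
    (fun n => (measurable_gradient (φ n).1).aestronglyMeasurable)
    (measurable_gradient ψ.1).aestronglyMeasurable h2).exists_seq_tendsto_ae

/-- A sequence of `1`-Lipschitz functions that converges almost everywhere converges everywhere. -/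
theorem exists_lipschitz_limit {f : ℕ → Space N → ℝ} (hf : ∀ n, LipschitzWith 1 (f n))
    (h : ∀ᵐ x, ∃ l, Tendsto (fun n => f n x) atTop (𝓝 l)) :
    ∃ u, LipschitzWith 1 u ∧ ∀ x, Tendsto (fun n => f n x) atTop (𝓝 (u x)) := by
  have hd := Measure.dense_of_ae h
  have hex : ∀ x, ∃ l, Tendsto (fun n => f n x) atTop (𝓝 l) := by
    intro x
    refine cauchySeq_tendsto_of_complete (Metric.cauchySeq_iff.2 fun ε hε => ?_)
    obtain ⟨y, ⟨l, hl⟩, hy⟩ := hd.exists_dist_lt x (show 0 < ε / 3 by positivity)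
    obtain ⟨n₀, hn₀⟩ := Metric.cauchySeq_iff.1 hl.cauchySeq (ε / 3) (by positivity)
    refine ⟨n₀, fun m hm n hn => ?_⟩
    have h1 := (hf m).dist_le_mul x y
    have h2 := (hf n).dist_le_mul y x
    have h3 := hn₀ m hm n hn
    have h4 := dist_triangle4 (f m x) (f m y) (f n y) (f n x)
    rw [dist_comm y x] at h2
    simp only [NNReal.coe_one, one_mul] at h1 h2
    linarith
  choose u hu using hex
  refine ⟨u, LipschitzWith.of_dist_le_mul fun x y => ?_, hu⟩
  exact le_of_tendsto ((hu x).dist (hu y)) (Eventually.of_forall fun n => (hf n).dist_le_mul x y)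

/-- `𝒳` is complete. -/
theorem exists_tendsto_of_cauchy (hN : 3 ≤ N) {φ : ℕ → X N}
    (hc : ∀ ε : ℝ, 0 < ε → ∃ n₀, ∀ m ≥ n₀, ∀ n ≥ n₀, xNorm ((φ m).1 - (φ n).1) < ε) :
    ∃ ψ : X N, Tendsto (fun n => xNorm ((φ n).1 - ψ.1)) atTop (𝓝 0) := by
  obtain ⟨C, hC⟩ := eLpNorm_sub_le (N := N) hN
  have hcE : ∀ ε : ℝ≥0∞, 0 < ε → ∃ n₀ : ℕ, ∀ m ≥ n₀, ∀ n ≥ n₀,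
      ENNReal.ofReal (xNorm ((φ m).1 - (φ n).1)) < ε := by
    intro ε hε
    obtain ⟨δ, hδ0, hδ⟩ := ENNReal.lt_iff_exists_nnreal_btwn.1 hε
    obtain ⟨n₀, h⟩ := hc δ (by exact_mod_cast hδ0)
    refine ⟨n₀, fun m hm n hn => lt_of_le_of_lt ?_ hδ⟩
    exact ENNReal.ofReal_le_coe.2 (h m hm n hn).le
  obtain ⟨G, hG, hGlim⟩ := exists_tendsto_eLpNorm_of_cauchy (p := 2) (by norm_num)
    (fun n => X.memLp_gradient hN (φ n)) (by
      intro ε hε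
      obtain ⟨n₀, h⟩ := hcE ε hε
      refine ⟨n₀, fun m hm n hn => ?_⟩
      rw [eLpNorm_gradient_sub hN]
      exact h m hm n hn)
  obtain ⟨f, hf, hflim⟩ := exists_tendsto_eLpNorm_of_cauchy (one_le_sobolevExp hN)
    (fun n => X.memLp hN (φ n)) (by
      intro ε hε
      obtain ⟨n₀, h⟩ := hcE (ε / (C + 1)) (ENNReal.div_pos hε.ne' (by finiteness))
      refine ⟨n₀, fun m hm n hn => (hC _ _).trans_lt ?_⟩
      have h1 := h m hm n hn
      rw [ENNReal.lt_div_iff_mul_lt (Or.inl (by simp)) (Or.inl (by finiteness))] at h1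
      refine lt_of_le_of_lt ?_ h1
      rw [mul_comm]
      gcongr
      exact le_self_add)
  -- The `L^{2*}` limit is only a class of functions; almost everywhere convergence of a subsequence
  -- of 1-Lipschitz functions selects its 1-Lipschitz representative `u`.
  obtain ⟨ns, hns, hae⟩ := (tendstoInMeasure_of_tendsto_eLpNorm (sobolevExp_ne_zero hN)
    (fun n => (X.memLp hN (φ n)).1) hf.1 hflim).exists_seq_tendsto_ae
  obtain ⟨u, hu, hulim⟩ := exists_lipschitz_limit (fun n => (X.lipschitzWith (φ (ns n))))
    (hae.mono fun x hx => ⟨_, hx⟩)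
  have hfu : f =ᵐ[volume] u := hae.mono fun x hx => tendsto_nhds_unique hx (hulim x)
  have hulp : Tendsto (fun n => eLpNorm (fun x => (φ n).1 x - u x) (sobolevExp N) volume) atTop
      (𝓝 0) := by
    refine hflim.congr fun n => eLpNorm_congr_ae ?_
    filter_upwards [hfu] with x hx
    rw [hx]
  -- A diagonal choice of test functions shows that `u` lies in `D^{1,2}`. For `n = 0` the bound is
  -- `⊤`, hence harmless.
  have hv : ∀ n : ℕ, ∃ v, IsTest v ∧
      eLpNorm (fun x => ∇ v x - ∇ (φ n).1 x) 2 volume < (n : ℝ≥0∞)⁻¹ ∧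
      eLpNorm (fun x => v x - (φ n).1 x) (sobolevExp N) volume < (n : ℝ≥0∞)⁻¹ := by
    intro n
    obtain ⟨v, hv, h1, h2⟩ := (X.memD12 (φ n)).exists_seq hN (X.lipschitzWith (φ n))
    have hpos : (0 : ℝ≥0∞) < (n : ℝ≥0∞)⁻¹ := ENNReal.inv_pos.2 (ENNReal.natCast_ne_top n)
    obtain ⟨k, hk1, hk2⟩ := ((h1.eventually (gt_mem_nhds hpos)).and
      (h2.eventually (gt_mem_nhds hpos))).exists
    exact ⟨v k, hv k, hk1, hk2⟩
  choose v hv hv1 hv2 using hv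
  have hz : ∀ s : ℕ → ℝ≥0∞, (∀ n, s n < (n : ℝ≥0∞)⁻¹) → Tendsto s atTop (𝓝 0) := fun s hs =>
    tendsto_of_tendsto_of_tendsto_of_le_of_le tendsto_const_nhds
      ENNReal.tendsto_inv_nat_nhds_zero (fun _ => zero_le) fun n => (hs n).le
  have hm : ∀ w : Space N → ℝ, AEStronglyMeasurable (∇ w) volume := fun w =>
    (measurable_gradient w).aestronglyMeasurable
  have hvG : Tendsto (fun n => eLpNorm (fun x => ∇ (v n) x - G x) 2 volume) atTop (𝓝 0) := by
    refine (tendsto_eLpNorm_add_zero (by norm_num) (fun n => (hm (v n)).sub (hm (φ n).1))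
      (fun n => (hm (φ n).1).sub hG.1) (hz _ hv1) hGlim).congr fun n => ?_
    congr 1; ext1 x; simp
  have hvu : Tendsto (fun n => eLpNorm (fun x => v n x - u x) (sobolevExp N) volume) atTop
      (𝓝 0) := by
    refine (tendsto_eLpNorm_add_zero (one_le_sobolevExp hN)
      (fun n => ((hv n).memLp (sobolevExp N)).1.sub (X.memLp hN (φ n)).1)
      (fun n => (X.memLp hN (φ n)).1.sub hu.continuous.aestronglyMeasurable) (hz _ hv2)
      hulp).congr fun n => ?_
    congr 1; ext1 x; simp
  have huD := memD12_of_tendsto hv hG.1 hvG hvu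
  have huX : u ∈ X N := ⟨huD, ⟨1, hu⟩, Eventually.of_forall fun x => by
    rw [norm_gradient]; exact norm_fderiv_le_of_lipschitz ℝ hu⟩
  have hGu : G =ᵐ[volume] ∇ u := by
    have h1 := (tendsto_gradient hN hu hv (cauchy_eLpNorm_gradient hG.1 hvG) hvu).2
    have h2 := tendstoInMeasure_of_tendsto_eLpNorm (by norm_num) (fun n => hm (v n)) hG.1 hvG
    have h3 := tendstoInMeasure_of_tendsto_eLpNorm (by norm_num) (fun n => hm (v n)) (hm u) h1
    exact tendstoInMeasure_ae_unique h2 h3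
  refine ⟨⟨u, huX⟩, ?_⟩
  have h1 : Tendsto (fun n => eLpNorm (fun x => ∇ (φ n).1 x - ∇ u x) 2 volume) atTop (𝓝 0) := by
    refine hGlim.congr fun n => eLpNorm_congr_ae ?_
    filter_upwards [hGu] with x hx
    rw [hx]
  have h2 := (ENNReal.tendsto_toReal ENNReal.zero_ne_top).comp h1
  rw [ENNReal.toReal_zero] at h2
  refine h2.congr fun n => ?_
  have h3 := eLpNorm_gradient_sub hN (φ n) ⟨u, huX⟩
  simp only [Function.comp_apply]
  rw [h3, ENNReal.toReal_ofReal xNorm_nonneg]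

end X

/-! ### Convexity inequalities for the energy density -/

section Density

variable {V : Type*} [NormedAddCommGroup V]

/-- The Born–Infeld energy density `1 - √(1 - |p|²)`. -/
noncomputable def density (p : V) : ℝ := 1 - Real.sqrt (1 - ‖p‖ ^ 2)

theorem one_sub_sq_nonneg {p : V} (hp : ‖p‖ ≤ 1) : 0 ≤ 1 - ‖p‖ ^ 2 := by
  nlinarith [norm_nonneg p]

theorem density_nonneg (p : V) : 0 ≤ density p := by
  rw [density, sub_nonneg, Real.sqrt_le_one]
  nlinarith [norm_nonneg p]

theorem density_le {p : V} (hp : ‖p‖ ≤ 1) : density p ≤ ‖p‖ ^ 2 := by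
  have h := one_sub_sq_nonneg hp
  have h1 : 1 - ‖p‖ ^ 2 ≤ Real.sqrt (1 - ‖p‖ ^ 2) :=
    Real.le_sqrt_of_sq_le (by nlinarith [sq_nonneg ‖p‖])
  rw [density]
  linarith

theorem le_density {p : V} (hp : ‖p‖ ≤ 1) : ‖p‖ ^ 2 / 2 ≤ density p := by
  have h1 : Real.sqrt (1 - ‖p‖ ^ 2) ≤ 1 - ‖p‖ ^ 2 / 2 :=
    Real.sqrt_le_iff.2 ⟨by nlinarith [norm_nonneg p], by nlinarith [sq_nonneg (‖p‖ ^ 2)]⟩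
  rw [density]
  linarith

theorem continuous_density : Continuous (density : V → ℝ) := by
  unfold density
  fun_prop

variable [InnerProductSpace ℝ V]

/-- Uniform convexity of the energy density. -/
theorem density_midpoint {p q : V} (hp : ‖p‖ ≤ 1) (hq : ‖q‖ ≤ 1) :
    density ((2⁻¹ : ℝ) • p + (2⁻¹ : ℝ) • q) + ‖p - q‖ ^ 2 / 8 ≤ (density p + density q) / 2 := by
  have hm : ‖(2⁻¹ : ℝ) • p + (2⁻¹ : ℝ) • q‖ ^ 2 =
      (‖p‖ ^ 2 + ‖q‖ ^ 2) / 2 - ‖p - q‖ ^ 2 / 4 := by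
    rw [← smul_add, norm_smul, mul_pow, Real.norm_of_nonneg (by norm_num : (0 : ℝ) ≤ 2⁻¹),
      @norm_add_sq_real, @norm_sub_sq_real]
    ring
  rw [density, hm, density, density]
  set d := ‖p - q‖ ^ 2
  have hd : 0 ≤ d := sq_nonneg _
  have ha := Real.sq_sqrt (one_sub_sq_nonneg hp)
  have hb := Real.sq_sqrt (one_sub_sq_nonneg hq)
  have ha0 := Real.sqrt_nonneg (1 - ‖p‖ ^ 2)
  have hb0 := Real.sqrt_nonneg (1 - ‖q‖ ^ 2)
  set a := Real.sqrt (1 - ‖p‖ ^ 2)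
  set b := Real.sqrt (1 - ‖q‖ ^ 2)
  have hm0 : 0 ≤ (‖p‖ ^ 2 + ‖q‖ ^ 2) / 2 - d / 4 := hm ▸ sq_nonneg _
  have hd4 : d ≤ 4 := by nlinarith [norm_nonneg p, norm_nonneg q]
  -- Since `hm0` bounds the mean of the squared norms below by `d / 4`, one has `((a + b) / 2)² ≤ 1
  -- - d / 4 ≤ (1 - d / 8)²`. This controls the cross term when `hkey` is squared.
  have hab : (a + b) / 2 ≤ 1 - d / 8 := by
    have h : ((a + b) / 2) ^ 2 ≤ (1 - d / 8) ^ 2 := by nlinarith [sq_nonneg (a - b)]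
    exact abs_le_of_sq_le_sq' h (by linarith) |>.2
  have hkey : (a + b) / 2 + d / 8 ≤
      Real.sqrt (1 - ((‖p‖ ^ 2 + ‖q‖ ^ 2) / 2 - d / 4)) := by
    refine Real.le_sqrt_of_sq_le ?_
    nlinarith [sq_nonneg (a - b), mul_nonneg hd (sub_nonneg.2 hab)]
  linarith

/-- With `a = √(1 - |p|²)` and `b = √(1 - |q|²)`, the points `(p, a)` and `(q, b)` lie on the unit
sphere of `V × ℝ`, and the first-order remainder is their squared chord divided by `2a`. This exact
formula yields both the convexity inequality and the quadratic upper bound. -/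
theorem density_sub_density {p q : V} (hp : ‖p‖ < 1) (hq : ‖q‖ ≤ 1) :
    density q - density p = inner ℝ p (q - p) / Real.sqrt (1 - ‖p‖ ^ 2) +
      ((Real.sqrt (1 - ‖p‖ ^ 2) - Real.sqrt (1 - ‖q‖ ^ 2)) ^ 2 + ‖q - p‖ ^ 2) /
        (2 * Real.sqrt (1 - ‖p‖ ^ 2)) := by
  have hpos : 0 < 1 - ‖p‖ ^ 2 := by nlinarith [norm_nonneg p]
  have ha := Real.sq_sqrt hpos.le
  have hb := Real.sq_sqrt (one_sub_sq_nonneg hq)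
  have ha0 := Real.sqrt_pos.2 hpos
  rw [density, density, inner_sub_right, real_inner_self_eq_norm_sq, @norm_sub_sq_real,
    real_inner_comm]
  set a := Real.sqrt (1 - ‖p‖ ^ 2)
  set b := Real.sqrt (1 - ‖q‖ ^ 2)
  field_simp
  nlinarith

theorem inner_div_le_density_sub {p q : V} (hp : ‖p‖ < 1) (hq : ‖q‖ ≤ 1) :
    inner ℝ p (q - p) / Real.sqrt (1 - ‖p‖ ^ 2) ≤ density q - density p := by
  rw [density_sub_density hp hq]
  have : 0 ≤ ((Real.sqrt (1 - ‖p‖ ^ 2) - Real.sqrt (1 - ‖q‖ ^ 2)) ^ 2 + ‖q - p‖ ^ 2) /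
        (2 * Real.sqrt (1 - ‖p‖ ^ 2)) := by positivity
  linarith

/-- Only `p` has to stay away from the unit sphere. Then `a ≥ κ`, and `|a - b| (a + b) = | |p|² -
|q|² |` gives `|a - b| ≤ 2|q - p|/κ`, so the remainder is quadratic with a constant that depends on
`κ` alone. -/
theorem density_sub_le {p q : V} {κ : ℝ} (hκ : 0 < κ) (hp : ‖p‖ ≤ 1 - κ) (hq : ‖q‖ ≤ 1) :
    density q - density p ≤ inner ℝ p (q - p) / Real.sqrt (1 - ‖p‖ ^ 2) +
      (4 / κ ^ 2 + 1) / (2 * κ) * ‖q - p‖ ^ 2 := by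
  have hp1 : ‖p‖ < 1 := by linarith
  rw [density_sub_density hp1 hq]
  have hκ1 : κ ≤ 1 := by linarith [norm_nonneg p]
  have hpos : 0 < 1 - ‖p‖ ^ 2 := by nlinarith [norm_nonneg p]
  have ha := Real.sq_sqrt hpos.le
  have hb := Real.sq_sqrt (one_sub_sq_nonneg hq)
  have hb0 := Real.sqrt_nonneg (1 - ‖q‖ ^ 2)
  have haκ : κ ≤ Real.sqrt (1 - ‖p‖ ^ 2) :=
    Real.le_sqrt_of_sq_le (by nlinarith [norm_nonneg p])
  set a := Real.sqrt (1 - ‖p‖ ^ 2)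
  set b := Real.sqrt (1 - ‖q‖ ^ 2)
  have hpq : |‖q‖ - ‖p‖| ≤ ‖q - p‖ := abs_norm_sub_norm_le q p
  have h1 : |a - b| * κ ≤ 2 * ‖q - p‖ := by
    calc |a - b| * κ ≤ |a - b| * (a + b) := by gcongr; linarith
      _ = |(a - b) * (a + b)| := by rw [abs_mul, abs_of_nonneg (by linarith : 0 ≤ a + b)]
      _ = |(‖q‖ + ‖p‖) * (‖q‖ - ‖p‖)| := by congr 1; linear_combination ha - hb
      _ = (‖q‖ + ‖p‖) * |‖q‖ - ‖p‖| := by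
        rw [abs_mul, abs_of_nonneg (by positivity : 0 ≤ ‖q‖ + ‖p‖)]
      _ ≤ 2 * ‖q - p‖ := by
        have : ‖q‖ + ‖p‖ ≤ 2 := by linarith
        gcongr
  have h2 : (a - b) ^ 2 ≤ 4 / κ ^ 2 * ‖q - p‖ ^ 2 := by
    rw [div_mul_eq_mul_div, le_div_iff₀ (by positivity), ← sq_abs (a - b), ← mul_pow]
    calc (|a - b| * κ) ^ 2 ≤ (2 * ‖q - p‖) ^ 2 := by gcongr
      _ = _ := by ring
  refine add_le_add le_rfl ?_
  calc ((a - b) ^ 2 + ‖q - p‖ ^ 2) / (2 * a)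
      ≤ (4 / κ ^ 2 * ‖q - p‖ ^ 2 + ‖q - p‖ ^ 2) / (2 * κ) := by gcongr
    _ = _ := by ring

end Density

/-- A form of Fatou's lemma. -/
theorem integral_le_of_ae_tendsto {α : Type*} [MeasurableSpace α] {μ : Measure α}
    {f : ℕ → α → ℝ} {g : α → ℝ} {L : ℝ} (hf : ∀ n, Integrable (f n) μ) (hg : Integrable g μ)
    (hf0 : ∀ n x, 0 ≤ f n x) (hg0 : ∀ x, 0 ≤ g x)
    (hlim : ∀ᵐ x ∂μ, Tendsto (fun n => f n x) atTop (𝓝 (g x)))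
    (hL : Tendsto (fun n => ∫ x, f n x ∂μ) atTop (𝓝 L)) : ∫ x, g x ∂μ ≤ L := by
  have hL0 : 0 ≤ L := ge_of_tendsto' hL fun n => integral_nonneg (hf0 n)
  rw [← ENNReal.ofReal_le_ofReal_iff hL0,
    ofReal_integral_eq_lintegral_ofReal hg (Eventually.of_forall hg0)]
  have h1 : ∫⁻ x, ENNReal.ofReal (g x) ∂μ =
      ∫⁻ x, liminf (fun n => ENNReal.ofReal (f n x)) atTop ∂μ := by
    refine lintegral_congr_ae ?_
    filter_upwards [hlim] with x hx
    exact (((ENNReal.continuous_ofReal.tendsto _).comp hx).liminf_eq).symm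
  rw [h1]
  refine (lintegral_liminf_le' fun n => (hf n).aemeasurable.ennreal_ofReal).trans ?_
  refine le_of_eq (Tendsto.liminf_eq ?_)
  refine ((ENNReal.continuous_ofReal.tendsto L).comp hL).congr fun n => ?_
  exact ofReal_integral_eq_lintegral_ofReal (hf n) (Eventually.of_forall (hf0 n))

theorem X.integrable_density (hN : 3 ≤ N) (φ : X N) :
    Integrable (fun x => density (∇ φ.1 x)) volume := by
  refine (X.integrable_norm_sq hN φ).mono'
    (continuous_density.measurable.comp (measurable_gradient φ.1)).aestronglyMeasurable ?_
  filter_upwards [X.ae_norm_gradient_le φ] with x hx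
  rw [Real.norm_of_nonneg (density_nonneg _)]
  exact density_le hx

theorem action_eq (ρ : XDual N) (φ : X N) :
    action ρ φ = (∫ x, density (∇ φ.1 x)) - ρ.pairing φ := rfl

/-! ### Minimization of uniformly convex functionals -/

section Minimization

theorem X.zero_mem (hN : 3 ≤ N) : (0 : Space N → ℝ) ∈ X N := by
  refine ⟨memD12_of_hasCompactSupport (K := 0) hN (LipschitzWith.const 0)
    HasCompactSupport.zero, ⟨0, LipschitzWith.const 0⟩, Eventually.of_forall fun x => ?_⟩
  rw [norm_gradient]
  simp

/-- The midpoint inequality bounds the squared distance of two almost minimizers by their excess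
over the infimum, so a minimizing sequence is Cauchy and `𝒳` is complete. The set and the functional
are left general for two uses: the action on `𝒳`, and the squared norm on a slice of `𝒳` with
prescribed defect. -/
theorem exists_minimizer (hN : 3 ≤ N) {C : Set (X N)} (hne : C.Nonempty) {F : X N → ℝ} {c : ℝ}
    (hc : 0 < c) {B : ℝ} (hB : ∀ φ ∈ C, B ≤ F φ)
    (hmid : ∀ φ ∈ C, ∀ ψ ∈ C, ∃ χ ∈ C, F χ + c * xNorm (φ.1 - ψ.1) ^ 2 ≤ (F φ + F ψ) / 2)
    (hlsc : ∀ (φ : ℕ → X N) (ψ : X N) (L : ℝ), (∀ n, φ n ∈ C) →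
      Tendsto (fun n => xNorm ((φ n).1 - ψ.1)) atTop (𝓝 0) →
      (∀ᵐ x, Tendsto (fun n => ∇ (φ n).1 x) atTop (𝓝 (∇ ψ.1 x))) →
      Tendsto (fun n => F (φ n)) atTop (𝓝 L) → ψ ∈ C ∧ F ψ ≤ L) :
    ∃ φ ∈ C, ∀ ψ ∈ C, F φ ≤ F ψ := by
  have hbdd : BddBelow (F '' C) := ⟨B, by rintro _ ⟨φ, hφ, rfl⟩; exact hB φ hφ⟩
  set m := sInf (F '' C) with hm
  have hmle : ∀ φ ∈ C, m ≤ F φ := fun φ hφ => csInf_le hbdd ⟨φ, hφ, rfl⟩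
  have hseq : ∀ n : ℕ, ∃ φ ∈ C, F φ < m + 1 / ((n : ℝ) + 1) := by
    intro n
    have hpos : (0 : ℝ) < 1 / ((n : ℝ) + 1) := by positivity
    obtain ⟨_, ⟨φ, hφ, rfl⟩, h⟩ := exists_lt_of_csInf_lt (hne.image F)
      (show sInf (F '' C) < m + 1 / ((n : ℝ) + 1) by linarith)
    exact ⟨φ, hφ, h⟩
  choose φ hφC hφ using hseq
  obtain ⟨ψ, hψ⟩ := X.exists_tendsto_of_cauchy hN (φ := φ) (by
    intro ε hε
    obtain ⟨n₀, hn₀⟩ := exists_nat_one_div_lt (show 0 < c * ε ^ 2 by positivity)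
    refine ⟨n₀, fun k hk l hl => ?_⟩
    have hinv : ∀ j : ℕ, n₀ ≤ j → 1 / ((j : ℝ) + 1) ≤ 1 / ((n₀ : ℝ) + 1) := fun j hj => by
      gcongr
    obtain ⟨χ, hχ, h⟩ := hmid _ (hφC k) _ (hφC l)
    have h1 := hmle χ hχ
    have h2 := (hφ k).trans_le (add_le_add_right (hinv k hk) m)
    have h3 := (hφ l).trans_le (add_le_add_right (hinv l hl) m)
    have h4 : c * xNorm ((φ k).1 - (φ l).1) ^ 2 < c * ε ^ 2 := by linarith
    exact lt_of_pow_lt_pow_left₀ 2 hε.le (lt_of_mul_lt_mul_left h4 hc.le))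
  obtain ⟨ns, hns, hae⟩ := X.exists_subseq_ae_tendsto hN hψ
  have hFm : Tendsto (fun n => F (φ n)) atTop (𝓝 m) := by
    have h0 : Tendsto (fun n : ℕ => m + 1 / ((n : ℝ) + 1)) atTop (𝓝 (m + 0)) :=
      tendsto_const_nhds.add tendsto_one_div_add_atTop_nhds_zero_nat
    rw [add_zero] at h0
    exact tendsto_of_tendsto_of_tendsto_of_le_of_le tendsto_const_nhds h0
      (fun n => hmle _ (hφC n)) fun n => (hφ n).le
  obtain ⟨hψC, hle⟩ := hlsc (fun n => φ (ns n)) ψ m (fun n => hφC _)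
    (hψ.comp hns.tendsto_atTop) hae (hFm.comp hns.tendsto_atTop)
  exact ⟨ψ, hψC, fun χ hχ => hle.trans (hmle χ hχ)⟩

theorem minimizer_unique (hN : 3 ≤ N) {C : Set (X N)} {F : X N → ℝ} {c : ℝ} (hc : 0 < c)
    (hmid : ∀ φ ∈ C, ∀ ψ ∈ C, ∃ χ ∈ C, F χ + c * xNorm (φ.1 - ψ.1) ^ 2 ≤ (F φ + F ψ) / 2)
    {φ ψ : X N} (hφ : φ ∈ C) (hψ : ψ ∈ C) (hφm : ∀ χ ∈ C, F φ ≤ F χ) (hψm : ∀ χ ∈ C, F ψ ≤ F χ) :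
    φ = ψ := by
  obtain ⟨χ, hχ, h⟩ := hmid φ hφ ψ hψ
  have h1 := hφm χ hχ
  have h2 := hψm χ hχ
  have h3 : xNorm (φ.1 - ψ.1) ^ 2 ≤ 0 := by
    by_contra h4
    have := mul_pos hc (not_le.1 h4)
    linarith
  exact X.eq_of_xNorm_sub_eq_zero hN (by nlinarith [xNorm_nonneg (u := φ.1 - ψ.1)])

end Minimization

/-! ### The pairing, and the minimizer of the action -/

section Pairing

variable (ρ : XDual N)

theorem pairing_lincomb (φ ψ : X N) (a b : ℝ) (h : a • φ.1 + b • ψ.1 ∈ X N) :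
    ρ.pairing ⟨a • φ.1 + b • ψ.1, h⟩ = a * ρ.pairing φ + b * ρ.pairing ψ := by
  have h1 : (⟨a • φ.1 + b • ψ.1, Submodule.subset_span h⟩ : Submodule.span ℝ (X N)) =
      a • ⟨φ.1, Submodule.subset_span φ.2⟩ + b • ⟨ψ.1, Submodule.subset_span ψ.2⟩ := rfl
  rw [XDual.pairing, h1, map_add, map_smul, map_smul]
  rfl

theorem tendsto_pairing {φ : ℕ → X N} {ψ : X N}
    (h : Tendsto (fun n => xNorm ((φ n).1 - ψ.1)) atTop (𝓝 0)) :
    Tendsto (fun n => ρ.pairing (φ n)) atTop (𝓝 (ρ.pairing ψ)) := by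
  rw [Metric.tendsto_atTop]
  intro ε hε
  obtain ⟨δ, hδ, hδε⟩ := ρ.continuous_on_X ψ ε hε
  obtain ⟨n₀, hn₀⟩ := eventually_atTop.1 (h.eventually (gt_mem_nhds hδ))
  exact ⟨n₀, fun n hn => hδε (φ n) (hn₀ n hn)⟩

theorem xNorm_smul (φ : X N) (a : ℝ) : xNorm (a • φ.1) = |a| * xNorm φ.1 := by
  have h : (fun x => ‖∇ (a • φ.1) x‖ ^ 2) =ᵐ[volume] fun x => a ^ 2 * ‖∇ φ.1 x‖ ^ 2 := by
    filter_upwards [X.ae_gradient_lincomb φ φ a 0] with x hx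
    rw [zero_smul, zero_smul, add_zero, add_zero] at hx
    rw [hx, norm_smul, mul_pow, Real.norm_eq_abs, sq_abs]
  rw [xNorm, integral_congr_ae h, integral_const_mul, Real.sqrt_mul (sq_nonneg a),
    Real.sqrt_sq_eq_abs, xNorm]

theorem exists_pairing_le (hN : 3 ≤ N) :
    ∃ K : ℝ, ∀ φ : X N, ρ.pairing φ ≤ K * xNorm φ.1 + 1 := by
  obtain ⟨δ, hδ, h⟩ := ρ.continuous_on_X ⟨0, X.zero_mem hN⟩ 1 one_pos
  have h0 : ρ.toLinearMap ⟨0, Submodule.subset_span (X.zero_mem hN)⟩ = 0 := ρ.toLinearMap.map_zero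
  have hsmall : ∀ φ : X N, xNorm φ.1 < δ → ρ.pairing φ < 1 := by
    intro φ hφ
    have h1 := h φ (by simpa using hφ)
    rw [h0, sub_zero] at h1
    exact (abs_lt.1 h1).2
  refine ⟨2 / δ, fun φ => ?_⟩
  have hnn := xNorm_nonneg (u := φ.1)
  by_cases hφ : xNorm φ.1 < δ
  · have h1 := hsmall φ hφ
    have h2 : 0 ≤ 2 / δ * xNorm φ.1 := by positivity
    linarith
  · rw [not_lt] at hφ
    have hpos : 0 < xNorm φ.1 := hδ.trans_le hφ
    -- Elements of `𝒳` may be shrunk but not enlarged: a large `φ` is scaled down to norm `δ / 2`,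
    -- where continuity at 0 applies.
    set t := δ / (2 * xNorm φ.1) with ht
    have ht0 : 0 < t := by positivity
    have ht1 : t ≤ 1 := by rw [ht, div_le_one (by positivity)]; linarith
    have hmem : t • φ.1 + (0 : ℝ) • φ.1 ∈ X N :=
      X.lincomb_mem_of_abs_add_abs_le hN φ φ (by rw [abs_of_pos ht0, abs_zero, add_zero]; exact ht1)
    have h1 := hsmall ⟨_, hmem⟩ (by
      simp only [zero_smul, add_zero]
      rw [xNorm_smul, abs_of_pos ht0, ht]
      field_simp
      linarith)
    rw [pairing_lincomb, zero_mul, add_zero, ht, div_mul_eq_mul_div,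
      div_lt_one (by positivity)] at h1
    have h2 : ρ.pairing φ ≤ 2 / δ * xNorm φ.1 := by
      rw [div_mul_eq_mul_div, le_div_iff₀ hδ]
      linarith
    linarith

theorem action_midpoint (hN : 3 ≤ N) (φ ψ : X N) :
    ∃ χ : X N, action ρ χ + 8⁻¹ * xNorm (φ.1 - ψ.1) ^ 2 ≤ (action ρ φ + action ρ ψ) / 2 := by
  have hmem : (2⁻¹ : ℝ) • φ.1 + (2⁻¹ : ℝ) • ψ.1 ∈ X N :=
    X.lincomb_mem_of_abs_add_abs_le hN φ ψ (by norm_num [abs_of_pos])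
  refine ⟨⟨_, hmem⟩, ?_⟩
  rw [action_eq, action_eq, action_eq, pairing_lincomb, X.xNorm_sub_sq]
  have h1 : (∫ x, density (∇ ((2⁻¹ : ℝ) • φ.1 + (2⁻¹ : ℝ) • ψ.1) x)) +
      8⁻¹ * ∫ x, ‖∇ φ.1 x - ∇ ψ.1 x‖ ^ 2 ≤
      ((∫ x, density (∇ φ.1 x)) + ∫ x, density (∇ ψ.1 x)) / 2 := by
    rw [← integral_const_mul, ← integral_add (X.integrable_density hN ⟨_, hmem⟩)
      ((X.integrable_norm_sub_sq hN φ ψ).const_mul _), ← integral_add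
      (X.integrable_density hN φ) (X.integrable_density hN ψ), ← integral_div]
    refine integral_mono_ae ((X.integrable_density hN ⟨_, hmem⟩).add
      ((X.integrable_norm_sub_sq hN φ ψ).const_mul _))
      (((X.integrable_density hN φ).add (X.integrable_density hN ψ)).div_const 2) ?_
    filter_upwards [X.ae_norm_gradient_le φ, X.ae_norm_gradient_le ψ,
      X.ae_gradient_lincomb φ ψ 2⁻¹ 2⁻¹] with x h1 h2 h3
    have h4 := density_midpoint h1 h2
    simp only [h3]
    linarith
  linarith

theorem isMinimizer_unique (hN : 3 ≤ N) {φ ψ : X N} (hφ : IsMinimizer ρ φ)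
    (hψ : IsMinimizer ρ ψ) : φ = ψ := by
  refine minimizer_unique (C := Set.univ) (F := action ρ) (c := 8⁻¹) hN (by norm_num)
    (fun χ _ χ' _ => ?_) trivial trivial (fun χ _ => hφ χ) fun χ _ => hψ χ
  obtain ⟨ξ, h⟩ := action_midpoint ρ hN χ χ'
  exact ⟨ξ, trivial, h⟩

theorem exists_isMinimizer (hN : 3 ≤ N) : ∃ φ : X N, IsMinimizer ρ φ := by
  obtain ⟨K, hK⟩ := exists_pairing_le ρ hN
  -- The lower bound is the minimum over `x` of `x² / 2 - K x - 1`, with `x` the norm of `φ`. Lower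
  -- semicontinuity is Fatou's lemma for the energy and continuity for the pairing.
  obtain ⟨φ, -, hφ⟩ := exists_minimizer (C := Set.univ) (F := action ρ) (c := 8⁻¹)
    (B := -(K ^ 2 / 2) - 1) hN ⟨⟨0, X.zero_mem hN⟩, trivial⟩ (by norm_num) (fun φ _ => by
      have h1 : xNorm φ.1 ^ 2 / 2 ≤ ∫ x, density (∇ φ.1 x) := by
        rw [xNorm_sq, ← integral_div]
        refine integral_mono_ae ((X.integrable_norm_sq hN φ).div_const 2)
          (X.integrable_density hN φ) ?_
        filter_upwards [X.ae_norm_gradient_le φ] with x hx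
        exact le_density hx
      have h2 := hK φ
      rw [action_eq]
      nlinarith [sq_nonneg (xNorm φ.1 - K)]) (fun χ _ χ' _ => by
      obtain ⟨ξ, h⟩ := action_midpoint ρ hN χ χ'
      exact ⟨ξ, trivial, h⟩) (fun φ ψ L _ hx hae hL => by
      refine ⟨trivial, ?_⟩
      have h1 : Tendsto (fun n => ∫ x, density (∇ (φ n).1 x)) atTop (𝓝 (L + ρ.pairing ψ)) := by
        refine (hL.add (tendsto_pairing ρ hx)).congr fun n => ?_
        rw [action_eq]
        ring
      have h2 := integral_le_of_ae_tendsto (fun n => X.integrable_density hN (φ n))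
        (X.integrable_density hN ψ) (fun n x => density_nonneg _) (fun x => density_nonneg _)
        (hae.mono fun x hx => (continuous_density.tendsto _).comp hx) h1
      rw [action_eq]
      linarith)
  exact ⟨φ, fun ψ => hφ ψ trivial⟩

end Pairing

/-! ### Integrability of the flux of a minimizer -/

/-- The integrand `∇φ·∇ψ/√(1 - |∇φ|²)` of the weak formulation. -/
noncomputable def flux (φ ψ : X N) (x : Space N) : ℝ :=
  inner ℝ (∇ φ.1 x) (∇ ψ.1 x) / Real.sqrt (1 - ‖∇ φ.1 x‖ ^ 2)

/-- The integrand `|∇φ|²/√(1 - |∇φ|²)`. -/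
noncomputable def selfFlux (φ : X N) (x : Space N) : ℝ :=
  ‖∇ φ.1 x‖ ^ 2 / Real.sqrt (1 - ‖∇ φ.1 x‖ ^ 2)

theorem measurable_flux (φ ψ : X N) : Measurable (flux φ ψ) :=
  ((measurable_gradient φ.1).inner (measurable_gradient ψ.1)).div
    (measurable_const.sub ((measurable_gradient φ.1).norm.pow_const 2)).sqrt

theorem measurable_selfFlux (φ : X N) : Measurable (selfFlux φ) :=
  ((measurable_gradient φ.1).norm.pow_const 2).div
    (measurable_const.sub ((measurable_gradient φ.1).norm.pow_const 2)).sqrt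

theorem selfFlux_nonneg (φ : X N) (x : Space N) : 0 ≤ selfFlux φ x := by
  unfold selfFlux
  positivity

/-- Rationalizing the difference quotient gives a denominator that stays positive even for `|p| =
1`, and a limit as `t → 0` that can be read off. -/
theorem density_sub_density_smul {V : Type*} [NormedAddCommGroup V] [NormedSpace ℝ V] {p : V}
    {t : ℝ} (hp : ‖p‖ ≤ 1) (ht0 : 0 < t) (ht1 : t < 1) :
    (density p - density ((1 - t) • p)) / t =
      ‖p‖ ^ 2 * (2 - t) /
        (Real.sqrt (1 - ‖p‖ ^ 2) + Real.sqrt (1 - (1 - t) ^ 2 * ‖p‖ ^ 2)) ∧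
      0 < Real.sqrt (1 - ‖p‖ ^ 2) + Real.sqrt (1 - (1 - t) ^ 2 * ‖p‖ ^ 2) := by
  have hs : ‖p‖ ^ 2 ≤ 1 := by nlinarith [norm_nonneg p]
  have hc : 0 < 1 - (1 - t) ^ 2 * ‖p‖ ^ 2 := by nlinarith [sq_nonneg (1 - t)]
  have hc2 := Real.sq_sqrt hc.le
  have ha2 := Real.sq_sqrt (sub_nonneg.2 hs)
  have hc0 := Real.sqrt_pos.2 hc
  have ha0 := Real.sqrt_nonneg (1 - ‖p‖ ^ 2)
  rw [density, density, norm_smul, mul_pow, Real.norm_eq_abs, sq_abs]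
  set a := Real.sqrt (1 - ‖p‖ ^ 2)
  set c := Real.sqrt (1 - (1 - t) ^ 2 * ‖p‖ ^ 2)
  have hpos : 0 < a + c := by linarith
  refine ⟨?_, hpos⟩
  rw [div_eq_div_iff ht0.ne' hpos.ne']
  linear_combination hc2 - ha2

/-- Minimality against `(1 - t)φ` bounds the integral of the nonnegative difference quotient by `⟨ρ,
φ⟩`; Fatou's lemma does the rest. The division is taken in `ℝ≥0∞` so that the integrand is infinite,
not 0, where `|∇φ| = 1`. -/
theorem IsMinimizer.lintegral_le (hN : 3 ≤ N) {ρ : XDual N} {φ : X N} (hφ : IsMinimizer ρ φ) :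
    ∫⁻ x, ENNReal.ofReal (‖∇ φ.1 x‖ ^ 2 * 2) /
      ENNReal.ofReal (Real.sqrt (1 - ‖∇ φ.1 x‖ ^ 2) + Real.sqrt (1 - ‖∇ φ.1 x‖ ^ 2)) ≤
      ENNReal.ofReal (ρ.pairing φ) := by
  set t : ℕ → ℝ := fun n => 1 / ((n : ℝ) + 2) with htdef
  have ht0 : ∀ n, 0 < t n := fun n => by simp only [htdef]; positivity
  have ht1 : ∀ n, t n < 1 := fun n => by
    simp only [htdef]
    rw [div_lt_one (by positivity)]
    linarith [n.cast_nonneg (α := ℝ)]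
  have htlim : Tendsto t atTop (𝓝 0) := by
    have h := (tendsto_add_atTop_iff_nat 1).2 (tendsto_one_div_add_atTop_nhds_zero_nat (𝕜 := ℝ))
    refine h.congr fun n => ?_
    simp only [htdef]
    push_cast
    ring
  set q : ℕ → Space N → ℝ := fun n x =>
    (density (∇ φ.1 x) - density ((1 - t n) • ∇ φ.1 x)) / t n with hq
  have hmem : ∀ n, (1 - t n) • φ.1 + (0 : ℝ) • φ.1 ∈ X N := fun n =>
    X.lincomb_mem_of_abs_add_abs_le hN φ φ (by
      rw [abs_of_pos (by linarith [ht1 n]), abs_zero]; linarith [ht0 n])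
  have hgrad : ∀ n, ∀ᵐ x, ∇ ((1 - t n) • φ.1 + (0 : ℝ) • φ.1) x = (1 - t n) • ∇ φ.1 x := fun n => by
    filter_upwards [X.ae_gradient_lincomb φ φ (1 - t n) 0] with x hx
    rw [hx, zero_smul, add_zero]
  have hint : ∀ n, Integrable (fun x => density ((1 - t n) • ∇ φ.1 x)) volume := fun n => by
    refine (X.integrable_density hN ⟨_, hmem n⟩).congr ?_
    filter_upwards [hgrad n] with x hx
    rw [hx]
  have hqint : ∀ n, Integrable (q n) volume := fun n =>
    ((X.integrable_density hN φ).sub (hint n)).div_const _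
  have hq0 : ∀ n, ∀ᵐ x, 0 ≤ q n x := fun n => by
    filter_upwards [X.ae_norm_gradient_le φ] with x hx
    obtain ⟨h1, h2⟩ := density_sub_density_smul hx (ht0 n) (ht1 n)
    simp only [hq]
    rw [h1]
    exact div_nonneg (mul_nonneg (sq_nonneg _) (by linarith [ht1 n])) h2.le
  have hqle : ∀ n, ∫ x, q n x ≤ ρ.pairing φ := fun n => by
    have h1 := hφ ⟨_, hmem n⟩
    rw [action_eq, action_eq, pairing_lincomb] at h1
    have h2 : ∫ x, density (∇ ((1 - t n) • φ.1 + (0 : ℝ) • φ.1) x) =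
        ∫ x, density ((1 - t n) • ∇ φ.1 x) := by
      refine integral_congr_ae ?_
      filter_upwards [hgrad n] with x hx
      rw [hx]
    simp only at h1
    rw [h2] at h1
    simp only [hq]
    rw [integral_div, integral_sub (X.integrable_density hN φ) (hint n), div_le_iff₀ (ht0 n)]
    linarith
  have hlim : ∀ᵐ x, Tendsto (fun n => ENNReal.ofReal (q n x)) atTop
      (𝓝 (ENNReal.ofReal (‖∇ φ.1 x‖ ^ 2 * 2) / ENNReal.ofReal
        (Real.sqrt (1 - ‖∇ φ.1 x‖ ^ 2) + Real.sqrt (1 - ‖∇ φ.1 x‖ ^ 2)))) := by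
    filter_upwards [X.ae_norm_gradient_le φ] with x hx
    set s := ‖∇ φ.1 x‖ ^ 2 with hs
    have hs1 : s ≤ 1 := by nlinarith [norm_nonneg (∇ φ.1 x)]
    have hnum : Tendsto (fun n => ENNReal.ofReal (s * (2 - t n))) atTop
        (𝓝 (ENNReal.ofReal (s * 2))) := by
      refine (ENNReal.continuous_ofReal.tendsto _).comp ?_
      have := (tendsto_const_nhds (x := (2 : ℝ))).sub htlim |>.const_mul s
      rwa [sub_zero] at this
    have hden : Tendsto (fun n => ENNReal.ofReal
        (Real.sqrt (1 - s) + Real.sqrt (1 - (1 - t n) ^ 2 * s))) atTop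
        (𝓝 (ENNReal.ofReal (Real.sqrt (1 - s) + Real.sqrt (1 - s)))) := by
      refine (ENNReal.continuous_ofReal.tendsto _).comp ?_
      have hcont : Continuous fun r : ℝ => Real.sqrt (1 - s) + Real.sqrt (1 - (1 - r) ^ 2 * s) := by
        fun_prop
      have := (hcont.tendsto 0).comp htlim
      simpa [Function.comp_def] using this
    refine (ENNReal.Tendsto.div hnum ?_ hden (Or.inl ENNReal.ofReal_ne_top)).congr fun n => ?_
    -- Where `s = 1` the denominator tends to 0 but the numerator tends to 2, so division in `ℝ≥0∞`
    -- is still continuous there.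
    · by_cases hs0 : s = 1
      · left; rw [hs0]; simp
      · right
        rw [Ne, ENNReal.ofReal_eq_zero, not_le]
        have : 0 < Real.sqrt (1 - s) := Real.sqrt_pos.2 (sub_pos.2 (lt_of_le_of_ne hs1 hs0))
        linarith
    · obtain ⟨h1, h2⟩ := density_sub_density_smul hx (ht0 n) (ht1 n)
      simp only [hq]
      rw [h1, ENNReal.ofReal_div_of_pos h2]
  calc _ = ∫⁻ x, liminf (fun n => ENNReal.ofReal (q n x)) atTop :=
        lintegral_congr_ae (hlim.mono fun x hx => hx.liminf_eq.symm)
    _ ≤ liminf (fun n => ∫⁻ x, ENNReal.ofReal (q n x)) atTop :=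
        lintegral_liminf_le' fun n => (hqint n).aemeasurable.ennreal_ofReal
    _ ≤ liminf (fun _ : ℕ => ENNReal.ofReal (ρ.pairing φ)) atTop := by
        refine liminf_le_liminf (Eventually.of_forall fun n => ?_)
        rw [← ofReal_integral_eq_lintegral_ofReal (hqint n) (hq0 n)]
        exact ENNReal.ofReal_le_ofReal (hqle n)
    _ = _ := liminf_const _

theorem IsMinimizer.ae_norm_gradient_lt (hN : 3 ≤ N) {ρ : XDual N} {φ : X N}
    (hφ : IsMinimizer ρ φ) : ∀ᵐ x, ‖∇ φ.1 x‖ < 1 := by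
  have hm : Measurable fun x => ENNReal.ofReal (‖∇ φ.1 x‖ ^ 2 * 2) /
      ENNReal.ofReal (Real.sqrt (1 - ‖∇ φ.1 x‖ ^ 2) + Real.sqrt (1 - ‖∇ φ.1 x‖ ^ 2)) := by
    have h := (measurable_gradient φ.1).norm.pow_const 2
    exact (h.mul_const 2).ennreal_ofReal.div
      ((measurable_const.sub h).sqrt.add (measurable_const.sub h).sqrt).ennreal_ofReal
  filter_upwards [ae_lt_top hm ((hφ.lintegral_le hN).trans_lt ENNReal.ofReal_lt_top).ne,
    X.ae_norm_gradient_le φ] with x hx hx1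
  refine lt_of_le_of_ne hx1 fun h => ?_
  rw [h] at hx
  simp [ENNReal.div_zero] at hx

theorem IsMinimizer.integrable_selfFlux (hN : 3 ≤ N) {ρ : XDual N} {φ : X N}
    (hφ : IsMinimizer ρ φ) : Integrable (selfFlux φ) volume := by
  refine ⟨(measurable_selfFlux φ).aestronglyMeasurable, ?_⟩
  rw [hasFiniteIntegral_iff_ofReal (Eventually.of_forall (selfFlux_nonneg φ))]
  refine lt_of_le_of_lt (le_of_eq (lintegral_congr_ae ?_))
    ((hφ.lintegral_le hN).trans_lt ENNReal.ofReal_lt_top)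
  filter_upwards [hφ.ae_norm_gradient_lt hN] with x hx
  have hpos : 0 < Real.sqrt (1 - ‖∇ φ.1 x‖ ^ 2) :=
    Real.sqrt_pos.2 (by nlinarith [norm_nonneg (∇ φ.1 x)])
  rw [← ENNReal.ofReal_div_of_pos (by linarith), selfFlux]
  congr 1
  field_simp
  ring

/-- The split is at `|p| = 1/2`: above it `|p| ≤ 2|p|²`, below it the root is at least `1/2`. The
flux is thus controlled by an integrable weight times a bounded factor, plus a product of two `L²`
functions. -/
theorem abs_inner_div_le {V : Type*} [NormedAddCommGroup V] [InnerProductSpace ℝ V] {p : V}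
    (hp : ‖p‖ ≤ 1) (d : V) :
    |inner ℝ p d / Real.sqrt (1 - ‖p‖ ^ 2)| ≤
      2 * (‖p‖ ^ 2 / Real.sqrt (1 - ‖p‖ ^ 2)) * ‖d‖ + 2 * (‖p‖ * ‖d‖) := by
  have ha0 := Real.sqrt_nonneg (1 - ‖p‖ ^ 2)
  rw [abs_div, abs_of_nonneg ha0]
  have h1 : |inner ℝ p d| ≤ ‖p‖ * ‖d‖ := abs_real_inner_le_norm p d
  by_cases h : 2⁻¹ ≤ ‖p‖
  · have h2 : ‖p‖ ≤ 2 * ‖p‖ ^ 2 := by nlinarith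
    calc |inner ℝ p d| / Real.sqrt (1 - ‖p‖ ^ 2)
        ≤ (2 * ‖p‖ ^ 2 * ‖d‖) / Real.sqrt (1 - ‖p‖ ^ 2) := by
          gcongr
          exact h1.trans (by gcongr)
      _ = 2 * (‖p‖ ^ 2 / Real.sqrt (1 - ‖p‖ ^ 2)) * ‖d‖ := by ring
      _ ≤ _ := le_add_of_nonneg_right (by positivity)
  · have h2 : 2⁻¹ ≤ Real.sqrt (1 - ‖p‖ ^ 2) :=
      Real.le_sqrt_of_sq_le (by nlinarith [norm_nonneg p])
    calc |inner ℝ p d| / Real.sqrt (1 - ‖p‖ ^ 2)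
        ≤ (‖p‖ * ‖d‖) / 2⁻¹ := by gcongr
      _ = 2 * (‖p‖ * ‖d‖) := by ring
      _ ≤ _ := le_add_of_nonneg_left (by positivity)

theorem X.integrable_norm_mul_norm (hN : 3 ≤ N) (φ : X N) {d : Space N → Space N}
    (hd : MemLp d 2 volume) : Integrable (fun x => ‖∇ φ.1 x‖ * ‖d x‖) volume :=
  (X.memLp_gradient hN φ).norm.integrable_mul hd.norm

theorem integrable_flux (hN : 3 ≤ N) {φ : X N} (hφ : Integrable (selfFlux φ) volume) (ψ : X N) :
    Integrable (flux φ ψ) volume := by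
  refine ((hφ.const_mul 2).add ((X.integrable_norm_mul_norm hN φ
    (X.memLp_gradient hN ψ)).const_mul 2)).mono' (measurable_flux φ ψ).aestronglyMeasurable ?_
  filter_upwards [X.ae_norm_gradient_le φ, X.ae_norm_gradient_le ψ] with x h1 h2
  refine (abs_inner_div_le h1 _).trans ?_
  have h3 := mul_le_mul_of_nonneg_left h2 (mul_nonneg zero_le_two (selfFlux_nonneg φ x))
  rw [mul_one] at h3
  exact add_le_add h3 le_rfl

/-- In the bound `abs_inner_div_le`, dominated convergence handles the term with `selfFlux`, where
the difference of gradients is at most 2, and Hölder's inequality handles the other. -/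
theorem tendsto_integral_flux (hN : 3 ≤ N) {φ : X N} (hφ : Integrable (selfFlux φ) volume)
    {ψ : ℕ → X N} {χ : X N} (hx : Tendsto (fun n => xNorm ((ψ n).1 - χ.1)) atTop (𝓝 0))
    (hae : ∀ᵐ x, Tendsto (fun n => ∇ (ψ n).1 x) atTop (𝓝 (∇ χ.1 x))) :
    Tendsto (fun n => ∫ x, flux φ (ψ n) x) atTop (𝓝 (∫ x, flux φ χ x)) := by
  have hdL : ∀ n, MemLp (fun x => ∇ (ψ n).1 x - ∇ χ.1 x) 2 volume := fun n =>
    (X.memLp_gradient hN (ψ n)).sub (X.memLp_gradient hN χ)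
  have hb2 : ∀ n, ∀ᵐ x, ‖∇ (ψ n).1 x - ∇ χ.1 x‖ ≤ 2 := fun n => by
    filter_upwards [X.ae_norm_gradient_le (ψ n), X.ae_norm_gradient_le χ] with x h1 h2
    linarith [norm_sub_le (∇ (ψ n).1 x) (∇ χ.1 x)]
  have hm1 : ∀ n, AEStronglyMeasurable
      (fun x => 2 * selfFlux φ x * ‖∇ (ψ n).1 x - ∇ χ.1 x‖) volume := fun n =>
    ((hφ.const_mul 2).aestronglyMeasurable).mul (hdL n).norm.aestronglyMeasurable
  have hbound : ∀ n, ∀ᵐ x, ‖2 * selfFlux φ x * ‖∇ (ψ n).1 x - ∇ χ.1 x‖‖ ≤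
      2 * selfFlux φ x * 2 := fun n => by
    filter_upwards [hb2 n] with x hx
    have := selfFlux_nonneg φ x
    rw [Real.norm_of_nonneg (by positivity)]
    gcongr
  have h1 : Tendsto (fun n => ∫ x, 2 * selfFlux φ x * ‖∇ (ψ n).1 x - ∇ χ.1 x‖) atTop (𝓝 0) := by
    have := tendsto_integral_of_dominated_convergence (f := fun _ => (0 : ℝ)) _ hm1
      ((hφ.const_mul 2).mul_const 2) hbound (by
        filter_upwards [hae] with x hx
        have := ((hx.sub_const (∇ χ.1 x)).norm).const_mul (2 * selfFlux φ x)
        simpa using this)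
    simpa using this
  have h2 : Tendsto (fun n => ∫ x, ‖∇ φ.1 x‖ • ‖∇ (ψ n).1 x - ∇ χ.1 x‖) atTop (𝓝 0) := by
    have := tendsto_integral_smul_of_tendsto_eLpNorm (p := 2) (q := 2) (w := fun x => ‖∇ φ.1 x‖)
      (f := fun n x => ‖∇ (ψ n).1 x - ∇ χ.1 x‖) (g := fun _ => (0 : ℝ))
      (X.memLp_gradient hN φ).norm (fun n => (hdL n).norm.aestronglyMeasurable)
      aestronglyMeasurable_const (fun n => X.integrable_norm_mul_norm hN φ (hdL n)) (by
        have h3 := (ENNReal.continuous_ofReal.tendsto 0).comp hx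
        rw [ENNReal.ofReal_zero] at h3
        refine h3.congr fun n => ?_
        simp only [sub_zero]
        rw [eLpNorm_norm]
        exact (X.eLpNorm_gradient_sub hN (ψ n) χ).symm)
    simpa using this
  have h3 := h1.add (h2.const_mul 2)
  rw [mul_zero, add_zero] at h3
  rw [tendsto_iff_norm_sub_tendsto_zero]
  refine tendsto_of_tendsto_of_tendsto_of_le_of_le tendsto_const_nhds h3
    (fun n => norm_nonneg _) fun n => ?_
  have hi1 : Integrable (fun x => 2 * selfFlux φ x * ‖∇ (ψ n).1 x - ∇ χ.1 x‖) volume :=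
    ((hφ.const_mul 2).mul_const 2).mono' (hm1 n) (hbound n)
  have hi2 := (X.integrable_norm_mul_norm hN φ (hdL n)).const_mul 2
  rw [← integral_sub (integrable_flux hN hφ _) (integrable_flux hN hφ _)]
  simp only [smul_eq_mul]
  rw [← integral_const_mul, ← integral_add hi1 hi2]
  refine norm_integral_le_of_norm_le (hi1.add hi2) ?_
  filter_upwards [X.ae_norm_gradient_le φ] with x hx
  rw [flux, flux, ← sub_div, ← inner_sub_right]
  exact abs_inner_div_le hx _

/-! ### The Euler–Lagrange equation away from the light cone -/

theorem eq_zero_of_forall_nonneg {D B κ : ℝ} (hκ : 0 < κ)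
    (h : ∀ t : ℝ, |t| ≤ κ → 0 ≤ t * D + B * t ^ 2) : D = 0 := by
  by_contra hD
  have hD0 : 0 < |D| := abs_pos.2 hD
  have hB := le_abs_self B
  -- With this `K`, the choice `t = -κ D / K` satisfies `|t| ≤ κ` and makes the linear term outweigh
  -- the quadratic one.
  set K := |D| + |B| * κ with hK
  have hKpos : 0 < K := by positivity
  have h1 := h (-(κ * D / K)) (by
    rw [abs_neg, abs_div, abs_mul, abs_of_pos hκ, abs_of_pos hKpos, div_le_iff₀ hKpos]
    gcongr
    exact le_add_of_nonneg_right (by positivity))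
  have h2 : -(κ * D / K) * D + B * (-(κ * D / K)) ^ 2 = κ * D ^ 2 / K ^ 2 * (B * κ - K) := by
    field_simp
    ring
  rw [h2] at h1
  have h3 : 0 < κ * D ^ 2 / K ^ 2 := by positivity
  have h4 : B * κ ≤ |B| * κ := by gcongr
  nlinarith

/-- The Euler–Lagrange equation of a minimizer, tested with a function whose gradient vanishes where
the gradient of the minimizer is close to the light cone. -/
theorem IsMinimizer.integral_flux_eq (hN : 3 ≤ N) {ρ : XDual N} {φ : X N} (hφ : IsMinimizer ρ φ)
    {η : X N} {κ : ℝ} (hκ : 0 < κ) (h : ∀ᵐ x, ∇ η.1 x = 0 ∨ ‖∇ φ.1 x‖ ≤ 1 - κ) :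
    ∫ x, flux φ η x = ρ.pairing η := by
  have hfi := integrable_flux hN (hφ.integrable_selfFlux hN) η
  rw [← sub_eq_zero]
  refine eq_zero_of_forall_nonneg (B := (4 / κ ^ 2 + 1) / (2 * κ) * ∫ x, ‖∇ η.1 x‖ ^ 2) hκ
    fun t ht => ?_
  -- Where `∇η ≠ 0` there is room `κ` below the constraint, so both signs of `t` are admissible and
  -- the first variation is an equality.
  have hle : ∀ᵐ x, ‖(1 : ℝ) • ∇ φ.1 x + t • ∇ η.1 x‖ ≤ 1 := by
    filter_upwards [h, X.ae_norm_gradient_le φ, X.ae_norm_gradient_le η] with x hx h1 h2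
    rw [one_smul]
    rcases hx with hx | hx
    · rwa [hx, smul_zero, add_zero]
    · calc _ ≤ ‖∇ φ.1 x‖ + ‖t • ∇ η.1 x‖ := norm_add_le _ _
        _ = ‖∇ φ.1 x‖ + |t| * ‖∇ η.1 x‖ := by rw [norm_smul, Real.norm_eq_abs]
        _ ≤ (1 - κ) + κ * 1 := by gcongr
        _ = 1 := by ring
  have hmem := X.lincomb_mem hN φ η hle
  have h1 := hφ ⟨_, hmem⟩
  rw [action_eq, action_eq, pairing_lincomb] at h1
  have h2 : (∫ x, density (∇ ((1 : ℝ) • φ.1 + t • η.1) x)) ≤ (∫ x, density (∇ φ.1 x)) +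
      (t * (∫ x, flux φ η x) + (4 / κ ^ 2 + 1) / (2 * κ) * t ^ 2 * ∫ x, ‖∇ η.1 x‖ ^ 2) := by
    have hi1 := hfi.const_mul t
    have hi2 := (X.integrable_norm_sq hN η).const_mul ((4 / κ ^ 2 + 1) / (2 * κ) * t ^ 2)
    rw [← integral_const_mul, ← integral_const_mul, ← integral_add hi1 hi2,
      ← integral_add (g := fun x => t * flux φ η x + _ * ‖∇ η.1 x‖ ^ 2)
        (X.integrable_density hN φ) (hi1.add hi2)]
    refine integral_mono_ae (X.integrable_density hN ⟨_, hmem⟩)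
      ((X.integrable_density hN φ).add (hi1.add hi2)) ?_
    filter_upwards [h, hle, X.ae_gradient_lincomb φ η 1 t] with x hx hx1 hx2
    simp only [flux]
    rw [hx2]
    rcases hx with hx | hx
    · simp [hx]
    · have h3 := density_sub_le hκ hx hx1
      rw [one_smul, add_sub_cancel_left, norm_smul, inner_smul_right, mul_pow, Real.norm_eq_abs,
        sq_abs] at h3
      rw [one_smul]
      calc _ ≤ _ := sub_le_iff_le_add'.1 h3
        _ = _ := by ring
  linarith

/-- A weak solution is a minimizer. -/
theorem IsWeakSolution.isMinimizer (hN : 3 ≤ N) {ρ : XDual N} {φ : X N}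
    (hφ : IsWeakSolution ρ φ) : IsMinimizer ρ φ := by
  intro ψ
  obtain ⟨hlt, hw⟩ := hφ
  have hint : ∀ χ : X N, Integrable (flux φ χ) volume := fun χ => (hw χ).1
  have h1 : (∫ x, flux φ ψ x) - ∫ x, flux φ φ x ≤
      (∫ x, density (∇ ψ.1 x)) - ∫ x, density (∇ φ.1 x) := by
    rw [← integral_sub (hint ψ) (hint φ),
      ← integral_sub (X.integrable_density hN ψ) (X.integrable_density hN φ)]
    refine integral_mono_ae ((hint ψ).sub (hint φ))
      ((X.integrable_density hN ψ).sub (X.integrable_density hN φ)) ?_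
    filter_upwards [hlt, X.ae_norm_gradient_le ψ] with x h1 h2
    have h3 := inner_div_le_density_sub h1 h2
    rwa [inner_sub_right, sub_div] at h3
  have h2 : ∫ x, flux φ ψ x = ρ.pairing ψ := (hw ψ).2
  have h3 : ∫ x, flux φ φ x = ρ.pairing φ := (hw φ).2
  rw [action_eq, action_eq]
  linarith

/-! ### Radial functions and their truncation -/

section RadialFunctions

variable {E : Type*} [NormedAddCommGroup E] [InnerProductSpace ℝ E]

theorem exists_linearIsometryEquiv_map_eq {x y : E} (h : ‖x‖ = ‖y‖) :
    ∃ τ : E ≃ₗᵢ[ℝ] E, τ x = y :=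
  ⟨(Submodule.span ℝ {x - y})ᗮ.reflection, Submodule.reflection_sub h⟩

theorem hasGradientAt_comp_norm [CompleteSpace E] {f : ℝ → ℝ} {f' : ℝ} {x : E} (hx : x ≠ 0)
    (hf : HasDerivAt f f' ‖x‖) : HasGradientAt (fun y => f ‖y‖) ((f' * ‖x‖⁻¹) • x) x := by
  have hx' : ‖x‖ ≠ 0 := norm_ne_zero_iff.2 hx
  have h1 : HasFDerivAt (fun y : E => ‖y‖) (‖x‖⁻¹ • innerSL ℝ x) x := by
    have h2 := (hasStrictFDerivAt_norm_sq x).hasFDerivAt.sqrt (pow_ne_zero 2 hx')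
    simp only [Real.sqrt_sq (norm_nonneg _)] at h2
    refine h2.congr_fderiv ?_
    ext y
    simp
    field_simp
  rw [hasGradientAt_iff_hasFDerivAt]
  refine (hf.comp_hasFDerivAt x h1).congr_fderiv ?_
  ext y
  simp [mul_assoc]

theorem norm_smul_inv_norm_smul {x : E} (hx : x ≠ 0) (c : ℝ) : ‖(c * ‖x‖⁻¹) • x‖ = |c| := by
  have hx' : ‖x‖ ≠ 0 := norm_ne_zero_iff.2 hx
  rw [norm_smul, norm_mul, norm_inv, norm_norm, mul_assoc, inv_mul_cancel₀ hx', mul_one,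
    Real.norm_eq_abs]

/-- A property that holds almost everywhere on `ℝ` holds for the norm of almost every vector. -/
theorem ae_norm_of_ae [FiniteDimensional ℝ E] [Nontrivial E] [MeasurableSpace E] [BorelSpace E]
    (μ : Measure E) [μ.IsAddHaarMeasure] {p : ℝ → Prop} (hp : ∀ᵐ r, p r) : ∀ᵐ x ∂μ, p ‖x‖ := by
  -- The exceptional set is enlarged to a measurable null set, whose indicator integrates to 0 in
  -- polar coordinates.
  set S := toMeasurable volume {r | ¬ p r} with hS
  have hSm : MeasurableSet S := measurableSet_toMeasurable _ _
  have hS0 : volume S = 0 := by rw [hS, measure_toMeasurable]; exact hp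
  have hae : ∀ᵐ r : ℝ, r ∉ S := measure_eq_zero_iff_ae_notMem.1 hS0
  have h0 : (fun y : ℝ => y ^ (Module.finrank ℝ E - 1) • S.indicator (fun _ => (1 : ℝ)) y)
      =ᵐ[volume.restrict (Set.Ioi 0)] fun _ => 0 := by
    refine ae_restrict_of_ae ?_
    filter_upwards [hae] with r hr
    rw [Set.indicator_of_notMem hr, smul_zero]
  have hint : Integrable (fun x : E => S.indicator (fun _ => (1 : ℝ)) ‖x‖) μ :=
    (integrable_fun_norm_addHaar μ).2 ((integrable_zero _ _ _).congr h0.symm)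
  have hzero : ∫ x, S.indicator (fun _ => (1 : ℝ)) ‖x‖ ∂μ = 0 := by
    rw [integral_fun_norm_addHaar, integral_congr_ae h0]
    simp
  rw [integral_eq_zero_iff_of_nonneg (fun x => Set.indicator_nonneg (by simp) _) hint] at hzero
  filter_upwards [hzero] with x hx
  by_contra hpx
  have hmem : ‖x‖ ∈ S := subset_toMeasurable _ _ hpx
  simp [Set.indicator_of_mem hmem] at hx

end RadialFunctions

theorem exists_norm_eq_one (hN : 3 ≤ N) : ∃ e : Space N, ‖e‖ = 1 :=
  ⟨EuclideanSpace.single ⟨0, by omega⟩ 1, by simp⟩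

theorem IsRadial.exists_profile (hN : 3 ≤ N) {φ : X N} (hφ : IsRadial φ) :
    ∃ f : ℝ → ℝ, LipschitzWith 1 f ∧ φ.1 = fun x => f ‖x‖ := by
  obtain ⟨e, he⟩ := exists_norm_eq_one hN
  refine ⟨fun r => φ.1 (r • e), LipschitzWith.of_dist_le_mul fun r s => ?_, ?_⟩
  · refine ((X.lipschitzWith φ).dist_le_mul _ _).trans (le_of_eq ?_)
    rw [dist_eq_norm, ← sub_smul, norm_smul, he, mul_one, dist_eq_norm]
  · ext x
    obtain ⟨τ, hτ⟩ := exists_linearIsometryEquiv_map_eq (x := x) (y := ‖x‖ • e)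
      (by rw [norm_smul, he, norm_norm, mul_one])
    have h := congrFun (congrArg Subtype.val (hφ τ)) x
    rw [← h]
    change φ.1 (τ x) = φ.1 (‖x‖ • e)
    rw [hτ]

theorem lipschitzWith_integral {k : ℝ → ℝ} (hk : ∀ r, |k r| ≤ 1) (hkm : Measurable k) (c : ℝ) :
    LipschitzWith 1 fun r => ∫ s in c..r, k s := by
  have hi : ∀ a b : ℝ, IntervalIntegrable k volume a b := fun a b =>
    (intervalIntegrable_const (c := (1 : ℝ))).mono_fun hkm.aestronglyMeasurable
      (Eventually.of_forall fun r => by simpa using hk r)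
  refine LipschitzWith.of_dist_le_mul fun r s => ?_
  rw [Real.dist_eq, intervalIntegral.integral_interval_sub_left (hi c r) (hi c s), Real.dist_eq,
    NNReal.coe_one]
  exact intervalIntegral.norm_integral_le_of_norm_le_const (f := k) fun t _ => hk t

/-- For radial `φ` and `η` in `𝒳`, there is a compactly supported function in `𝒳` whose gradient is
that of `η` on a ball intersected with `{|∇φ| ≤ 1 - κ}`, and is zero elsewhere. -/
theorem exists_truncation (hN : 3 ≤ N) {φ η : X N} (hφ : IsRadial φ) (hη : IsRadial η) (κ R : ℝ) :
    ∃ ξ : X N, ∀ᵐ x, (‖∇ φ.1 x‖ ≤ 1 - κ ∧ ‖x‖ ≤ R → ∇ ξ.1 x = ∇ η.1 x) ∧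
      (¬(‖∇ φ.1 x‖ ≤ 1 - κ ∧ ‖x‖ ≤ R) → ∇ ξ.1 x = 0) := by
  obtain ⟨f, hf, hφf⟩ := hφ.exists_profile hN
  obtain ⟨h, hh, hηh⟩ := hη.exists_profile hN
  set B : Set ℝ := {s | |deriv f s| ≤ 1 - κ ∧ s ≤ R} with hB
  have hBm : MeasurableSet B :=
    (measurableSet_le (measurable_deriv f).abs measurable_const).inter measurableSet_Iic
  set k : ℝ → ℝ := B.indicator (deriv h) with hk
  have hk1 : ∀ r, |k r| ≤ 1 := by
    intro r
    by_cases hr : r ∈ B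
    · rw [hk, Set.indicator_of_mem hr]
      exact norm_deriv_le_of_lipschitz hh
    · rw [hk, Set.indicator_of_notMem hr, abs_zero]
      exact zero_le_one
  have hkm : Measurable k := (measurable_deriv h).indicator hBm
  -- In one variable every bounded measurable function is almost everywhere a derivative; a general
  -- gradient field cut off by an indicator need not be a gradient. Integration starts at `R` so
  -- that `H` vanishes beyond `R`.
  set H : ℝ → ℝ := fun r => ∫ s in R..r, k s with hH
  have hHlip : LipschitzWith 1 H := lipschitzWith_integral hk1 hkm R
  have hHzero : ∀ r, R ≤ r → H r = 0 := by
    intro r hr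
    refine intervalIntegral.integral_zero_ae (Eventually.of_forall fun s hs => ?_)
    rw [Set.uIoc_of_le hr] at hs
    exact Set.indicator_of_notMem (fun hsB => not_le.2 hs.1 hsB.2) _
  have hξlip : LipschitzWith 1 fun x : Space N => H ‖x‖ := by
    refine LipschitzWith.of_dist_le_mul fun x y => (hHlip.dist_le_mul _ _).trans ?_
    simpa using (lipschitzWith_one_norm (E := Space N)).dist_le_mul x y
  have hξs : HasCompactSupport fun x : Space N => H ‖x‖ := by
    refine HasCompactSupport.intro (isCompact_closedBall (0 : Space N) R) fun x hx => ?_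
    refine hHzero _ ?_
    rw [Metric.mem_closedBall, dist_zero_right, not_le] at hx
    exact hx.le
  have hξX : (fun x : Space N => H ‖x‖) ∈ X N :=
    ⟨memD12_of_hasCompactSupport hN hξlip hξs, ⟨1, hξlip⟩, Eventually.of_forall fun x => by
      rw [norm_gradient]; exact norm_fderiv_le_of_lipschitz ℝ hξlip⟩
  have hkl : LocallyIntegrable k volume :=
    (memLp_top_of_bound hkm.aestronglyMeasurable 1
      (Eventually.of_forall hk1)).locallyIntegrable le_top
  have : Nontrivial (Space N) := by
    obtain ⟨e, he⟩ := exists_norm_eq_one hN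
    exact ⟨e, 0, fun h0 => by simp [h0] at he⟩
  refine ⟨⟨_, hξX⟩, ?_⟩
  filter_upwards [ae_norm_of_ae volume hf.ae_differentiableAt_real,
    ae_norm_of_ae volume hh.ae_differentiableAt_real,
    ae_norm_of_ae volume (LocallyIntegrable.ae_hasDerivAt_integral hkl),
    compl_mem_ae_iff.2 (measure_singleton (0 : Space N))] with x h1 h2 h3 hx0
  have g1 : ∇ φ.1 x = (deriv f ‖x‖ * ‖x‖⁻¹) • x := by
    rw [hφf]; exact (hasGradientAt_comp_norm hx0 h1.hasDerivAt).gradient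
  have g2 : ∇ η.1 x = (deriv h ‖x‖ * ‖x‖⁻¹) • x := by
    rw [hηh]; exact (hasGradientAt_comp_norm hx0 h2.hasDerivAt).gradient
  have g3 : ∇ (fun x : Space N => H ‖x‖) x = (k ‖x‖ * ‖x‖⁻¹) • x :=
    (hasGradientAt_comp_norm hx0 (h3 R)).gradient
  have hiff : (‖∇ φ.1 x‖ ≤ 1 - κ ∧ ‖x‖ ≤ R) ↔ ‖x‖ ∈ B := by
    rw [g1, norm_smul_inv_norm_smul hx0]
    rfl
  rw [hiff, g2]
  simp only [g3]
  refine ⟨fun hB => ?_, fun hB => ?_⟩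
  · rw [hk, Set.indicator_of_mem hB]
  · rw [hk, Set.indicator_of_notMem hB, zero_mul, zero_smul]

/-- Truncations with `κ = 1/(n + 1)` and `R = n` satisfy the equation. At almost every point their
gradient eventually equals `∇η`, since `|∇φ| < 1` there, and `|∇η|` dominates the error in `L²`;
both sides pass to the limit. -/
theorem IsMinimizer.integral_flux_eq_of_isRadial (hN : 3 ≤ N) {ρ : XDual N} {φ η : X N}
    (hφ : IsMinimizer ρ φ) (hφr : IsRadial φ) (hηr : IsRadial η) :
    ∫ x, flux φ η x = ρ.pairing η := by
  choose ξ hξ using fun n : ℕ => exists_truncation hN hφr hηr (1 / ((n : ℝ) + 1)) n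
  have hEL : ∀ n, ∫ x, flux φ (ξ n) x = ρ.pairing (ξ n) := fun n => by
    refine hφ.integral_flux_eq hN (κ := 1 / ((n : ℝ) + 1)) (by positivity) ?_
    filter_upwards [hξ n] with x hx
    by_cases hc : ‖∇ φ.1 x‖ ≤ 1 - 1 / ((n : ℝ) + 1) ∧ ‖x‖ ≤ n
    · exact Or.inr hc.1
    · exact Or.inl (hx.2 hc)
  have hae : ∀ᵐ x, Tendsto (fun n => ∇ (ξ n).1 x) atTop (𝓝 (∇ η.1 x)) := by
    filter_upwards [ae_all_iff.2 hξ, hφ.ae_norm_gradient_lt hN] with x hx hlt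
    refine tendsto_const_nhds.congr' ?_
    have h1 : ∀ᶠ n : ℕ in atTop, 1 / ((n : ℝ) + 1) < 1 - ‖∇ φ.1 x‖ :=
      tendsto_one_div_add_atTop_nhds_zero_nat.eventually (gt_mem_nhds (sub_pos.2 hlt))
    filter_upwards [h1, tendsto_natCast_atTop_atTop.eventually_ge_atTop ‖x‖] with n h2 h3
    exact ((hx n).1 ⟨by linarith, h3⟩).symm
  have hconv : Tendsto (fun n => xNorm ((ξ n).1 - η.1)) atTop (𝓝 0) := by
    have h1 := tendsto_eLpNorm_sub_of_dominated (p := 2) (by norm_num) (by norm_num)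
      (fun n => (measurable_gradient (ξ n).1).aestronglyMeasurable)
      (measurable_gradient η.1).aestronglyMeasurable (X.memLp_gradient hN η).norm
      (fun n => by
        filter_upwards [hξ n] with x hx
        by_cases hc : ‖∇ φ.1 x‖ ≤ 1 - 1 / ((n : ℝ) + 1) ∧ ‖x‖ ≤ n
        · rw [hx.1 hc, sub_self, norm_zero]; exact norm_nonneg _
        · rw [hx.2 hc, zero_sub, norm_neg]) hae
    have h2 := (ENNReal.tendsto_toReal ENNReal.zero_ne_top).comp h1
    rw [ENNReal.toReal_zero] at h2
    refine h2.congr fun n => ?_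
    simp only [Function.comp_apply]
    rw [X.eLpNorm_gradient_sub hN, ENNReal.toReal_ofReal xNorm_nonneg]
  exact tendsto_nhds_unique
    ((tendsto_integral_flux hN (hφ.integrable_selfFlux hN) hconv hae).congr hEL)
    (tendsto_pairing ρ hconv)

/-! ### Rotation invariance and arbitrary test functions -/

theorem integral_comp_orth (τ : OrthGroup N) (f : Space N → ℝ) : ∫ x, f (τ x) = ∫ x, f x :=
  τ.measurePreserving.integral_comp τ.toHomeomorph.measurableEmbedding f

theorem gradient_rotate (τ : OrthGroup N) (φ : X N) (x : Space N) :
    ∇ (rotate τ φ).1 x = τ.symm (∇ φ.1 (τ x)) :=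
  gradient_comp_orth τ φ.1 x

theorem xNorm_rotate (τ : OrthGroup N) (φ : X N) : xNorm (rotate τ φ).1 = xNorm φ.1 := by
  rw [xNorm, xNorm, ← integral_comp_orth τ fun x => ‖∇ φ.1 x‖ ^ 2]
  congr 1
  refine integral_congr_ae (Eventually.of_forall fun x => ?_)
  simp only [gradient_rotate, LinearIsometryEquiv.norm_map]

theorem action_rotate {ρ : XDual N} (hρ : IsRadiallyDistributed ρ) (τ : OrthGroup N) (φ : X N) :
    action ρ (rotate τ φ) = action ρ φ := by
  rw [action_eq, action_eq, hρ, ← integral_comp_orth τ fun x => density (∇ φ.1 x)]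
  congr 1
  refine integral_congr_ae (Eventually.of_forall fun x => ?_)
  simp only [density, gradient_rotate, LinearIsometryEquiv.norm_map]

theorem integral_flux_rotate {φ : X N} (hφ : IsRadial φ) (τ : OrthGroup N) (ψ : X N) :
    ∫ x, flux φ (rotate τ ψ) x = ∫ x, flux φ ψ x := by
  rw [← integral_comp_orth τ (flux φ ψ)]
  refine integral_congr_ae (Eventually.of_forall fun x => ?_)
  have h : ∇ φ.1 x = τ.symm (∇ φ.1 (τ x)) := by
    rw [← gradient_rotate, hφ τ]
  simp only [flux]
  rw [h, gradient_rotate, LinearIsometryEquiv.inner_map_map, LinearIsometryEquiv.norm_map]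

theorem IsMinimizer.isRadial (hN : 3 ≤ N) {ρ : XDual N} (hρ : IsRadiallyDistributed ρ) {φ : X N}
    (hφ : IsMinimizer ρ φ) : IsRadial φ := fun τ =>
  isMinimizer_unique ρ hN (fun ψ => by rw [action_rotate hρ]; exact hφ ψ) hφ

theorem xNorm_sq_midpoint (hN : 3 ≤ N) (φ ψ : X N) :
    xNorm ((2⁻¹ : ℝ) • φ.1 + (2⁻¹ : ℝ) • ψ.1) ^ 2 + 4⁻¹ * xNorm (φ.1 - ψ.1) ^ 2 =
      (xNorm φ.1 ^ 2 + xNorm ψ.1 ^ 2) / 2 := by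
  have h : ∀ᵐ x, ‖∇ ((2⁻¹ : ℝ) • φ.1 + (2⁻¹ : ℝ) • ψ.1) x‖ ^ 2 =
      (‖∇ φ.1 x‖ ^ 2 + ‖∇ ψ.1 x‖ ^ 2) / 2 - 4⁻¹ * ‖∇ φ.1 x - ∇ ψ.1 x‖ ^ 2 := by
    filter_upwards [X.ae_gradient_lincomb φ ψ 2⁻¹ 2⁻¹] with x hx
    rw [hx, ← smul_add, norm_smul, mul_pow, Real.norm_of_nonneg (by norm_num : (0 : ℝ) ≤ 2⁻¹),
      @norm_add_sq_real, @norm_sub_sq_real]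
    ring
  rw [X.xNorm_sub_sq, xNorm_sq, xNorm_sq, xNorm_sq, integral_congr_ae h,
    integral_sub (f := fun x => (‖∇ φ.1 x‖ ^ 2 + ‖∇ ψ.1 x‖ ^ 2) / 2)
      (((X.integrable_norm_sq hN φ).add (X.integrable_norm_sq hN ψ)).div_const 2)
      ((X.integrable_norm_sub_sq hN φ ψ).const_mul _), integral_const_mul, integral_div,
    integral_add (X.integrable_norm_sq hN φ) (X.integrable_norm_sq hN ψ)]
  ring

/-- The functions with a prescribed value of `∫ ∇φ·∇η/√(1 - |∇φ|²) - ⟨ρ, η⟩` include a radial one,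
namely the one of least norm. -/
theorem exists_isRadial_sub_eq (hN : 3 ≤ N) {ρ : XDual N} (hρ : IsRadiallyDistributed ρ) {φ : X N}
    (hφ : Integrable (selfFlux φ) volume) (hφr : IsRadial φ) (ψ : X N) :
    ∃ η : X N, IsRadial η ∧
      (∫ x, flux φ η x) - ρ.pairing η = (∫ x, flux φ ψ x) - ρ.pairing ψ := by
  set C : Set (X N) :=
    {η | (∫ x, flux φ η x) - ρ.pairing η = (∫ x, flux φ ψ x) - ρ.pairing ψ} with hC
  have hmid : ∀ η ∈ C, ∀ χ ∈ C, ∃ ξ ∈ C,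
      xNorm ξ.1 ^ 2 + 4⁻¹ * xNorm (η.1 - χ.1) ^ 2 ≤ (xNorm η.1 ^ 2 + xNorm χ.1 ^ 2) / 2 := by
    intro η hη χ hχ
    have hmem : (2⁻¹ : ℝ) • η.1 + (2⁻¹ : ℝ) • χ.1 ∈ X N :=
      X.lincomb_mem_of_abs_add_abs_le hN η χ (by norm_num [abs_of_pos])
    refine ⟨⟨_, hmem⟩, ?_, (xNorm_sq_midpoint hN η χ).le⟩
    have h1 : ∫ x, flux φ ⟨_, hmem⟩ x = 2⁻¹ * (∫ x, flux φ η x) + 2⁻¹ * ∫ x, flux φ χ x := by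
      rw [← integral_const_mul, ← integral_const_mul, ← integral_add
        ((integrable_flux hN hφ η).const_mul _) ((integrable_flux hN hφ χ).const_mul _)]
      refine integral_congr_ae ?_
      filter_upwards [X.ae_gradient_lincomb η χ 2⁻¹ 2⁻¹] with x hx
      simp only [flux]
      rw [hx, inner_add_right, inner_smul_right, inner_smul_right]
      ring
    simp only [hC, Set.mem_ofPred_eq] at hη hχ ⊢
    rw [h1, pairing_lincomb]
    linarith
  -- `C` is closed under midpoints because the defect is linear, and under limits by
  -- `tendsto_integral_flux`; the parallelogram identity supplies the convexity modulus `1/4`.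
  obtain ⟨η, hη, hmin⟩ := exists_minimizer (C := C) (F := fun η => xNorm η.1 ^ 2) (c := 4⁻¹)
    (B := 0) hN ⟨ψ, rfl⟩ (by norm_num) (fun η _ => sq_nonneg _) hmid (fun η χ L hη hx hae hL => by
      refine ⟨?_, ?_⟩
      · refine tendsto_nhds_unique
          ((tendsto_integral_flux hN hφ hx hae).sub (tendsto_pairing ρ hx)) ?_
        exact tendsto_const_nhds.congr fun n => (hη n).symm
      · rw [xNorm_sq]
        refine integral_le_of_ae_tendsto (fun n => X.integrable_norm_sq hN (η n))
          (X.integrable_norm_sq hN χ) (fun n x => sq_nonneg _) (fun x => sq_nonneg _)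
          (hae.mono fun x hx => hx.norm.pow 2) (hL.congr fun n => xNorm_sq))
  refine ⟨η, fun τ => ?_, hη⟩
  -- Rotations preserve both `C` and the norm, so uniqueness of the element of least norm forces it
  -- to be radial. This plays the role of averaging over `O(N)`.
  refine minimizer_unique (C := C) (F := fun η => xNorm η.1 ^ 2) (c := 4⁻¹) hN (by norm_num) hmid
    ?_ hη (fun χ hχ => ?_) hmin
  · simp only [hC, Set.mem_ofPred_eq] at hη ⊢
    rw [integral_flux_rotate hφr, hρ, hη]
  · simp only [xNorm_rotate]
    exact hmin χ hχ

theorem IsMinimizer.isWeakSolution (hN : 3 ≤ N) {ρ : XDual N} (hρ : IsRadiallyDistributed ρ)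
    {φ : X N} (hφ : IsMinimizer ρ φ) : IsWeakSolution ρ φ := by
  have hs := hφ.integrable_selfFlux hN
  have hr := hφ.isRadial hN hρ
  refine ⟨hφ.ae_norm_gradient_lt hN, fun ψ => ⟨integrable_flux hN hs ψ, ?_⟩⟩
  obtain ⟨η, hη, h⟩ := exists_isRadial_sub_eq hN hρ hs hr ψ
  rw [hφ.integral_flux_eq_of_isRadial hN hr hη, sub_self] at h
  exact sub_eq_zero.1 h.symm

end BornInfeld

theorem mainTheorem2 (N : ℕ) (hN : 3 ≤ N) (ρ : BornInfeld.XDual N)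
    (hρ : BornInfeld.IsRadiallyDistributed ρ) :
    ∃ φ : BornInfeld.X N,
      BornInfeld.IsMinimizer ρ φ ∧
      (∀ ψ : BornInfeld.X N, BornInfeld.IsMinimizer ρ ψ → ψ = φ) ∧
      BornInfeld.IsRadial φ ∧
      BornInfeld.IsWeakSolution ρ φ ∧
      (∀ ψ : BornInfeld.X N, BornInfeld.IsWeakSolution ρ ψ → ψ = φ) := by
  obtain ⟨φ, hφ⟩ := BornInfeld.exists_isMinimizer ρ hN
  exact ⟨φ, hφ, fun ψ hψ => BornInfeld.isMinimizer_unique ρ hN hψ hφ, hφ.isRadial hN hρ,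
    hφ.isWeakSolution hN hρ,
    fun ψ hψ => BornInfeld.isMinimizer_unique ρ hN (hψ.isMinimizer hN) hφ⟩
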